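/- Let $D_0,D_1,D_2$ be $m\times m$ complex Hermitian matrices, put $A(x)=x_0D_0+x_1D_1-x_2D_2$, and assume that $\Delta(x)=\det A(x)\in\mathbb C[x_0,x_1,x_2]$ is irreducible; let $C=\{\Delta=0\}\subset\mathbb P^2(\mathbb C)$. For $n\ge 0$ let $W_n$ be the space of families $w=(w_i)$ of vectors of $\mathbb C^m$ indexed by the multi-indices $i=(i_0,i_1,i_2)\in\mathbb Z_{\ge0}^3$ with $|i|=n-1$, and let the principal subspace $V_n\subset W_n$ consist of those $w$ with $$D_0w_{j_0+1,j_1,j_2}+D_1w_{j_0,j_1+1,j_2}-D_2w_{j_0,j_1,j_2+1}=0\qquad\text{whenever } |j|=n-2 .$$ For $x$ on $C$ (given by homogeneous coordinates) and $e\in\ker A(x)$, the Vandermonde vector is $V_n(x,e)=(x_0^{i_0}x_1^{i_1}x_2^{i_2}e)_{|i|=n-1}\in W_n$. Let $p\in\mathbb C[x_0,x_1,x_2]$ be a homogeneous polynomial of degree $n$ that does not vanish identically on $C$ (that is, $\Delta\nmid p$), let $Z$ be the set of zeros of $p$ on $C$, and for $x\in Z$ let $I_x$ be the intersection multiplicity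 at $x$ of $C$ with $\{p=0\}$. Fix homogeneous coordinates for each $x\in Z$. 1. For every choice of nonzero vectors $e_x\in\ker A(x)$, $x\in Z$, the vectors $V_n(x,e_x)$, $x\in Z$, are linearly independent. If all zeros of $p$ on $C$ are simple ($I_x=1$ for all $x\in Z$), they also span $V_n$. 2. For every choice of a basis $(e_{x,k})_k$ of $\ker A(x)$ for each $x\in Z$, the vectors $V_n(x,e_{x,k})$ (all $x\in Z$ and all $k$) are linearly independent, and they span $V_n$ if and only if $\dim\ker A(x)=I_x$ for every $x\in Z$. -/

import Mathlib

noncomputable section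

/-- The matrix `x₀ D₀ + x₁ D₁ - x₂ D₂` at a vector `x` of `ℂ³`. -/
def pencil {m : ℕ} (D : Fin 3 → Matrix (Fin m) (Fin m) ℂ) (x : Fin 3 → ℂ) :
    Matrix (Fin m) (Fin m) ℂ :=
  x 0 • D 0 + x 1 • D 1 - x 2 • D 2

/-- The polynomial `Δ(x₀, x₁, x₂) = det (x₀ D₀ + x₁ D₁ - x₂ D₂)`. -/
def detPoly {m : ℕ} (D : Fin 3 → Matrix (Fin m) (Fin m) ℂ) : MvPolynomial (Fin 3) ℂ :=
  Matrix.det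
    ((MvPolynomial.X 0 : MvPolynomial (Fin 3) ℂ) • (D 0).map MvPolynomial.C
      + (MvPolynomial.X 1 : MvPolynomial (Fin 3) ℂ) • (D 1).map MvPolynomial.C
      - (MvPolynomial.X 2 : MvPolynomial (Fin 3) ℂ) • (D 2).map MvPolynomial.C)

/-- The common zeros in `ℙ²` of two forms `p` and `q`. For homogeneous `p` and `q` the choice of
the representative does not matter. -/
def commonZeros (p q : MvPolynomial (Fin 3) ℂ) : Set (Projectivization ℂ (Fin 3 → ℂ)) :=
  {x | MvPolynomial.eval x.rep p = 0 ∧ MvPolynomial.eval x.rep q = 0}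

/-- Multi-indices `i = (i₀, i₁, i₂)` with `i₀ + i₁ + i₂ = n - 1` (none if `n = 0`). -/
abbrev BlockIndex (n : ℕ) : Type := {i : Fin 3 → ℕ // i 0 + i 1 + i 2 + 1 = n}

/-- The blown up space `W_n`: families of vectors of `ℂᵐ` indexed by the multi-indices of
weight `n - 1`. -/
abbrev BlownUpSpace (m n : ℕ) : Type := BlockIndex n → Fin m → ℂ

/-- The index `j + ε_k` of weight `n - 1`, for `j` of weight `n - 2`. -/
def raise {n : ℕ} (j : Fin 3 → ℕ) (hj : j 0 + j 1 + j 2 + 2 = n) (k : Fin 3) : BlockIndex n :=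
  ⟨j + Pi.single k 1, by
    fin_cases k <;> simp <;> omega⟩

/-- The Vandermonde vector `V_n(x, e) = (x₀^{i₀} x₁^{i₁} x₂^{i₂} e)_{|i| = n - 1}`. -/
def vandermondeVec {m : ℕ} (n : ℕ) (x : Fin 3 → ℂ) (e : Fin m → ℂ) : BlownUpSpace m n :=
  fun i => (x 0 ^ i.1 0 * x 1 ^ i.1 1 * x 2 ^ i.1 2) • e

/-- The principal subspace `V_n` of `W_n`: the families `w` with
`D₀ w_{j + ε₀} + D₁ w_{j + ε₁} - D₂ w_{j + ε₂} = 0` whenever `|j| = n - 2`. -/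
def principalSubspace {m : ℕ} (D : Fin 3 → Matrix (Fin m) (Fin m) ℂ) (n : ℕ) :
    Submodule ℂ (BlownUpSpace m n) where
  carrier := {w | ∀ (j : Fin 3 → ℕ) (hj : j 0 + j 1 + j 2 + 2 = n),
    (D 0).mulVec (w (raise j hj 0)) + (D 1).mulVec (w (raise j hj 1))
      - (D 2).mulVec (w (raise j hj 2)) = 0}
  zero_mem' := by
    intro j hj
    simp
  add_mem' := by
    intro a b ha hb j hj
    have h1 := ha j hj
    have h2 := hb j hj
    simp only [Pi.add_apply, Matrix.mulVec_add]
    rw [← add_zero (0 : Fin m → ℂ)]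
    nth_rewrite 1 [← h1]
    rw [← h2]
    abel
  smul_mem' := by
    intro c a ha j hj
    have h1 := ha j hj
    simp only [Pi.smul_apply, Matrix.mulVec_smul]
    rw [← smul_add, ← smul_sub, h1, smul_zero]

instance evalKerIsPrime (v : Fin 3 → ℂ) : (RingHom.ker (MvPolynomial.eval v)).IsPrime :=
  RingHom.ker_isPrime _

/-- The local ring of affine 3-space at the point `v`. -/
abbrev LocalRingAt (v : Fin 3 → ℂ) : Type :=
  Localization.AtPrime (RingHom.ker (MvPolynomial.eval v))

/-- The linear form `ℓ_v(y) = ∑ conj(v_k) y_k`, which does not vanish at `v` if `v ≠ 0`. -/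
def chartForm (v : Fin 3 → ℂ) : MvPolynomial (Fin 3) ℂ :=
  ∑ k : Fin 3, MvPolynomial.C (starRingEnd ℂ (v k)) * MvPolynomial.X k

/-- The intersection multiplicity at the point `[v]` of `ℙ²` (where `v ≠ 0`) of the plane curves
`p = 0` and `q = 0`, for forms `p` and `q` without common factor: the dimension over `ℂ` of
`𝒪 / (p, q)`, where `𝒪` is the local ring of `ℙ²` at `[v]`. The affine plane
`{y | ℓ_v(y) = ℓ_v(v)}` in `ℂ³` is the affine chart `ℓ_v ≠ 0` of `ℙ²`, so `𝒪` is
the local ring of this plane at `v`, that is, the local ring of `ℂ³` at `v` modulo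
`ℓ_v - ℓ_v(v)`. -/
def intersectionMult (p q : MvPolynomial (Fin 3) ℂ) (v : Fin 3 → ℂ) : ℕ :=
  Module.finrank ℂ (LocalRingAt v ⧸
    Ideal.map (algebraMap (MvPolynomial (Fin 3) ℂ) (LocalRingAt v))
      (Ideal.span {p, q,
        chartForm v - MvPolynomial.C (MvPolynomial.eval v (chartForm v))}))

end

/-! Let `R` be the polynomial ring in three variables and `n ≥ 1`. Pairing coefficients makes `W_n`
the dual of the `m`-tuples of forms of degree `n - 1` (`blownUpEquiv`). Under this duality `V_n` is
the annihilator of `Aᵀ` applied to the tuples of degree `n - 2`. Since `Δ ≠ 0`, `Aᵀ` is injective,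
so `dim V_n = m n` (`finrank_principalSubspace`). The vector `V_n(x, e)` becomes the functional `f ↦
e · f(x)` (`blockPairing_vandermondeVec`).

Independence is then a statement about evaluations along `ker A(x)`. As `Δ` is irreducible and does
not divide `p`, the Koszul type complex of `Aᵀ` and `p` is exact, and the Hilbert function of `Rᵐ /
(Aᵀ Rᵐ + p Rᵐ)` is constantly `m n` from degree `n - 1` on
(`finrank_formTuples_eq_finrank_formImage_add`). A linear form that vanishes at no point of `Z` is a
nonzerodivisor on this cokernel, hence bijective between these degrees. So on its affine chart every
tuple of polynomials is congruent to a tuple of forms of degree `n - 1` (`exists_formTuple_congr`).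
A combination of the functionals that vanishes in degree `n - 1` therefore vanishes on all tuples,
and polynomials separate points (`vandermondeSum_injective`).

The same results for the `1 × 1` matrix `Δ`, with the splitting of an Artinian ring into local
rings, give Bezout's theorem `∑ I_x = m n` (`sum_intersectionMult`).

Locally `dim ker A(x) ≤ I_x` (`finrank_ker_le_finrank_localQuot`). If the kernel has dimension `k ≥
1`, then `Δ` lies in the `k`-th power of the maximal ideal. If the `(k - 1)`-st power died in the
local intersection ring, Nakayama's lemma would put it inside an ideal with two generators in a
local ring of dimension three. The span of all kernel Vandermonde vectors has dimension `∑ dim ker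
A(x) ≤ ∑ I_x = dim V_n`, so it is everything exactly when all the local inequalities are equalities.
-/

open MvPolynomial

noncomputable section

/-! ### Forms in three variables, graded by `ℤ` -/

/-- The forms of degree `d` in three variables; only `0` if `d < 0`. -/
def forms (d : ℤ) : Submodule ℂ (MvPolynomial (Fin 3) ℂ) :=
  weightedHomogeneousSubmodule ℂ (fun _ => (1 : ℤ)) d

lemma weight_one_eq_degree (u : Fin 3 →₀ ℕ) :
    Finsupp.weight (fun _ => (1 : ℤ)) u = (u.degree : ℤ) := by
  simp [Finsupp.weight_apply, Finsupp.sum, Finsupp.degree_apply]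

lemma mem_forms {d : ℤ} {f : MvPolynomial (Fin 3) ℂ} :
    f ∈ forms d ↔ ∀ u, coeff u f ≠ 0 → (u.degree : ℤ) = d := by
  simp only [← weight_one_eq_degree]
  exact ⟨fun h u hu => h hu, fun h u hu => h u hu⟩

lemma mem_forms_iff_isHomogeneous {n : ℕ} {f : MvPolynomial (Fin 3) ℂ} :
    f ∈ forms n ↔ f.IsHomogeneous n := by
  rw [mem_forms]
  have hw (u : Fin 3 →₀ ℕ) : Finsupp.weight (1 : Fin 3 → ℕ) u = u.degree :=
    (DFunLike.congr_fun Finsupp.degree_eq_weight_one u).symm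
  constructor
  · intro h u hu
    rw [hw]
    exact_mod_cast h u hu
  · intro h u hu
    rw [← h hu, hw]

lemma mul_mem_forms {i j : ℤ} {f g : MvPolynomial (Fin 3) ℂ} (hf : f ∈ forms i)
    (hg : g ∈ forms j) : f * g ∈ forms (i + j) :=
  IsWeightedHomogeneous.mul hf hg

lemma pow_mem_forms {i : ℤ} {f : MvPolynomial (Fin 3) ℂ} (hf : f ∈ forms i) (k : ℕ) :
    f ^ k ∈ forms (k * i) := by
  have := IsWeightedHomogeneous.pow hf k
  rw [nsmul_eq_mul] at this
  exact this

lemma forms_eq_bot {d : ℤ} (hd : d < 0) : forms d = ⊥ := by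
  rw [eq_bot_iff]
  intro f hf
  rw [Submodule.mem_bot]
  ext u
  by_contra h
  have := mem_forms.1 hf u h
  omega

/-- The component of degree `d`. -/
def formComp (d : ℤ) : MvPolynomial (Fin 3) ℂ →ₗ[ℂ] MvPolynomial (Fin 3) ℂ :=
  weightedHomogeneousComponent (fun _ => (1 : ℤ)) d

lemma formComp_mem (d : ℤ) (f : MvPolynomial (Fin 3) ℂ) : formComp d f ∈ forms d :=
  weightedHomogeneousComponent_isWeightedHomogeneous _ _

lemma formComp_of_mem {d : ℤ} {f : MvPolynomial (Fin 3) ℂ} (hf : f ∈ forms d) :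
    formComp d f = f :=
  IsWeightedHomogeneous.weightedHomogeneousComponent_same hf

/-- Projecting an identity to one degree commutes with multiplication by a form. This is how
inhomogeneous witnesses are later replaced by forms. -/
lemma formComp_mul {i j : ℤ} {f : MvPolynomial (Fin 3) ℂ} (hf : f ∈ forms i)
    (g : MvPolynomial (Fin 3) ℂ) : formComp (i + j) (f * g) = f * formComp j g := by
  let _ := weightedGradedAlgebra ℂ (fun _ : Fin 3 => (1 : ℤ))
  have h := DirectSum.coe_decompose_mul_add_of_left_mem
    (weightedHomogeneousSubmodule ℂ (fun _ : Fin 3 => (1 : ℤ))) (i := i) (j := j) (b := g) hf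
  have h2 : ∀ (φ : MvPolynomial (Fin 3) ℂ) (m : ℤ), (DirectSum.decompose
      (weightedHomogeneousSubmodule ℂ (fun _ : Fin 3 => (1 : ℤ))) φ m : MvPolynomial (Fin 3) ℂ)
        = formComp m φ := fun φ m => decompose'_apply ℂ _ φ m
  rwa [h2, h2] at h

lemma iSup_forms : ⨆ d : ℕ, forms d = ⊤ := by
  rw [eq_top_iff]
  intro f _
  induction f using MvPolynomial.induction_on' with
  | monomial u a =>
    refine Submodule.mem_iSup_of_mem u.degree (mem_forms.2 fun v hv => ?_)
    rw [coeff_monomial] at hv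
    split_ifs at hv with h
    · rw [h]
    · exact absurd rfl hv
  | add p q hp hq => exact add_mem (hp trivial) (hq trivial)

/-- A form of degree `d` is given by its coefficients. -/
def formsEquiv (d : ℕ) :
    forms d ≃ₗ[ℂ] (((Finset.univ : Finset (Fin 3)).finsuppAntidiag d : Finset (Fin 3 →₀ ℕ)) → ℂ) where
  toFun f u := coeff u.1 f.1
  map_add' f g := by ext u; simp
  map_smul' c f := by ext u; simp
  invFun c := ⟨∑ u, monomial u.1 (c u), sum_mem fun u _ => mem_forms.2 fun v hv => by
    have hu := (Finset.mem_finsuppAntidiag.1 u.2).1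
    rw [coeff_monomial] at hv
    split_ifs at hv with h
    · rw [← h, Finsupp.degree_eq_sum]; exact_mod_cast hu
    · exact absurd rfl hv⟩
  left_inv f := by
    ext v
    simp only [coeff_sum, coeff_monomial]
    by_cases hv : coeff v f.1 = 0
    · rw [hv]
      refine Finset.sum_eq_zero fun u _ => ?_
      split_ifs with h
      · rw [h, hv]
      · rfl
    · have hd := mem_forms.1 f.2 v hv
      have hm : v ∈ (Finset.univ : Finset (Fin 3)).finsuppAntidiag d := by
        rw [Finset.mem_finsuppAntidiag]
        rw [Finsupp.degree_eq_sum] at hd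
        exact ⟨by exact_mod_cast hd, Finset.subset_univ _⟩
      rw [Finset.sum_eq_single ⟨v, hm⟩] <;> aesop
  right_inv c := by
    ext v
    simp only [coeff_sum, coeff_monomial]
    rw [Finset.sum_eq_single v] <;> aesop

instance finiteDimensional_forms (d : ℤ) : FiniteDimensional ℂ (forms d) := by
  rcases lt_or_ge d 0 with hd | hd
  · rw [forms_eq_bot hd]; infer_instance
  · lift d to ℕ using hd
    exact Module.Finite.equiv (formsEquiv d).symm

/-- The polynomial `(d + 1)(d + 2)` vanishes at `-1` and `-2`, so the count remains valid two steps
below zero. The sharp degree bound `a + n ≤ d + 2` in the Hilbert function rests on this. -/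
lemma finrank_forms {d : ℤ} (hd : 0 ≤ d + 2) :
    2 * (Module.finrank ℂ (forms d) : ℤ) = (d + 1) * (d + 2) := by
  rcases lt_or_ge d 0 with h | h
  · rw [forms_eq_bot h, finrank_bot]
    obtain rfl | rfl : d = -1 ∨ d = -2 := by omega
    all_goals norm_num
  · lift d to ℕ using h
    rw [(formsEquiv d).finrank_eq, Module.finrank_fintype_fun_eq_card, Fintype.card_coe,
      Finset.card_finsuppAntidiag_nat_eq_choose, Finset.card_univ, Fintype.card_fin]
    have h1 : (3 + d - 1).choose d = (d + 2).choose 2 := by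
      rw [show 3 + d - 1 = d + 2 by omega, ← Nat.choose_symm (by omega : 2 ≤ d + 2)]
      simp
    have h2 : 2 * (d + 2).choose 2 = (d + 1) * (d + 2) := by
      rw [Nat.choose_two_right, Nat.mul_div_cancel' (Nat.even_mul_pred_self _).two_dvd]
      simp [mul_comm]
    rw [h1]
    exact_mod_cast h2

lemma aeval_smul_of_mem_forms {S : Type*} [CommRing S] [Algebra ℂ S] {n : ℕ}
    {f : MvPolynomial (Fin 3) ℂ} (hf : f ∈ forms n) (c : S) (v : Fin 3 → S) :
    aeval (fun i => c * v i) f = c ^ n * aeval v f := by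
  rw [aeval_def, aeval_def, eval₂_eq, eval₂_eq, Finset.mul_sum]
  refine Finset.sum_congr rfl fun u hu => ?_
  have : (u.degree : ℤ) = n := mem_forms.1 hf u (mem_support_iff.1 hu)
  have hn : u.degree = n := by exact_mod_cast this
  simp only [mul_pow, Finset.prod_mul_distrib, Finset.prod_pow_eq_pow_sum]
  rw [← hn, Finsupp.degree_apply]
  ring

lemma eval_smul_of_mem_forms {n : ℕ} {f : MvPolynomial (Fin 3) ℂ} (hf : f ∈ forms n) (c : ℂ)
    (v : Fin 3 → ℂ) : eval (c • v) f = c ^ n * eval v f := by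
  have := aeval_smul_of_mem_forms hf c v
  simp only [aeval_eq_eval] at this
  exact this

/-! ### Tuples of forms. -/

/-- The families `(f_i)` of forms of degree `d`. -/
def formTuples (ι : Type*) (d : ℤ) : Submodule ℂ (ι → MvPolynomial (Fin 3) ℂ) :=
  Submodule.pi Set.univ fun _ => forms d

lemma mem_formTuples {ι : Type*} {d : ℤ} {f : ι → MvPolynomial (Fin 3) ℂ} :
    f ∈ formTuples ι d ↔ ∀ i, f i ∈ forms d := by
  simp [formTuples, Submodule.mem_pi]

/-- A tuple of forms is a function to the space of forms. -/
def formTuplesEquiv (ι : Type*) (d : ℤ) : formTuples ι d ≃ₗ[ℂ] (ι → forms d) where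
  toFun f i := ⟨f.1 i, mem_formTuples.1 f.2 i⟩
  invFun f := ⟨fun i => (f i).1, mem_formTuples.2 fun i => (f i).2⟩
  map_add' _ _ := rfl
  map_smul' _ _ := rfl
  left_inv _ := rfl
  right_inv _ := rfl

instance finiteDimensional_formTuples (ι : Type*) [Finite ι] (d : ℤ) :
    FiniteDimensional ℂ (formTuples ι d) :=
  Module.Finite.equiv (formTuplesEquiv ι d).symm

lemma finrank_formTuples (ι : Type*) [Fintype ι] {d : ℤ} (hd : 0 ≤ d + 2) :
    2 * (Module.finrank ℂ (formTuples ι d) : ℤ) = Fintype.card ι * ((d + 1) * (d + 2)) := by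
  rw [(formTuplesEquiv ι d).finrank_eq, Module.finrank_pi_fintype, Finset.sum_const,
    Finset.card_univ, ← finrank_forms hd]
  push_cast [smul_eq_mul]
  ring

lemma iSup_formTuples (ι : Type*) [Finite ι] : ⨆ d : ℕ, formTuples ι d = ⊤ := by
  classical
  have := Fintype.ofFinite ι
  rw [eq_top_iff]
  intro f _
  rw [← Finset.univ_sum_single f]
  refine sum_mem fun i _ => ?_
  have : ∀ x ∈ ⨆ d : ℕ, forms d, (Pi.single i x : ι → MvPolynomial (Fin 3) ℂ) ∈
      ⨆ d : ℕ, formTuples ι d := by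
    intro x hx
    induction hx using Submodule.iSup_induction' with
    | mem d x hx =>
      refine Submodule.mem_iSup_of_mem d (mem_formTuples.2 fun j => ?_)
      by_cases h : j = i
      · subst h; simpa using hx
      · simp [h]
    | zero => simp
    | add x y _ _ hx hy => rw [Pi.single_add]; exact add_mem hx hy
  exact this _ (iSup_forms ▸ trivial)

end

noncomputable section

/-! ### Cokernels of square matrices of forms -/

section Exactness

variable {S : Type*} [CommRing S] {ι : Type*} [Fintype ι] [DecidableEq ι]

lemma mulVec_injective_of_det_mem_nonZeroDivisors {A : Matrix ι ι S}
    (hA : A.det ∈ nonZeroDivisors S) {g : ι → S} (h : A.mulVec g = 0) : g = 0 := by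
  have h1 : A.adjugate.mulVec (A.mulVec g) = A.det • g := by
    rw [Matrix.mulVec_mulVec, Matrix.adjugate_mul, Matrix.smul_mulVec, Matrix.one_mulVec]
  rw [h, Matrix.mulVec_zero] at h1
  ext i
  have := congrFun h1 i
  simp only [Pi.zero_apply, Pi.smul_apply, smul_eq_mul] at this
  exact (mem_nonZeroDivisors_iff.1 hA).1 _ this.symm

/-- Exactness in the middle of the Koszul type complex of a matrix and a scalar. -/
lemma exists_of_mulVec_add_smul_eq_zero {A : Matrix ι ι S} {p : S}
    (hA : A.det ∈ nonZeroDivisors S) (hp : ∀ u, A.det ∣ p * u → A.det ∣ u) {g h : ι → S}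
    (e : A.mulVec g + p • h = 0) : ∃ h', h = A.mulVec h' ∧ g = -(p • h') := by
  have h1 : A.adjugate.mulVec (A.mulVec g) = A.det • g := by
    rw [Matrix.mulVec_mulVec, Matrix.adjugate_mul, Matrix.smul_mulVec, Matrix.one_mulVec]
  have h2 : A.mulVec (A.adjugate.mulVec h) = A.det • h := by
    rw [Matrix.mulVec_mulVec, Matrix.mul_adjugate, Matrix.smul_mulVec, Matrix.one_mulVec]
  -- The adjugate turns the relation into `det A • g = -p • adj(A) h`. The hypothesis on `p` then
  -- lets `det A` be divided out of `adj(A) h`.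
  have h3 : A.det • g + p • A.adjugate.mulVec h = 0 := by
    rw [← h1, ← Matrix.mulVec_smul, ← Matrix.mulVec_add, e, Matrix.mulVec_zero]
  have h4 : ∀ i, A.det ∣ A.adjugate.mulVec h i := fun i => hp _ ⟨-g i, by
    have := congrFun h3 i
    simp only [Pi.add_apply, Pi.smul_apply, smul_eq_mul, Pi.zero_apply] at this
    linear_combination this⟩
  choose h' hh' using h4
  have h5 : A.adjugate.mulVec h = A.det • h' := funext hh'
  have h6 : h = A.mulVec h' := by
    rw [h5, Matrix.mulVec_smul] at h2
    ext i
    have := congrFun h2 i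
    simp only [Pi.smul_apply, smul_eq_mul] at this
    exact ((mul_cancel_left_mem_nonZeroDivisors hA).1 this).symm
  refine ⟨h', h6, ?_⟩
  rw [← add_eq_zero_iff_eq_neg]
  refine mulVec_injective_of_det_mem_nonZeroDivisors hA ?_
  rw [Matrix.mulVec_add, Matrix.mulVec_smul, ← h6, e]

end Exactness

variable {ι : Type*} [Fintype ι]

/-- Multiplication of tuples of polynomials by a matrix, as a `ℂ`-linear map. -/
def matrixMap (A : Matrix ι ι (MvPolynomial (Fin 3) ℂ)) :
    (ι → MvPolynomial (Fin 3) ℂ) →ₗ[ℂ] (ι → MvPolynomial (Fin 3) ℂ) :=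
  A.mulVecLin.restrictScalars ℂ

/-- Multiplication of tuples of polynomials by a polynomial, as a `ℂ`-linear map. -/
def scalarMap (ι : Type*) (p : MvPolynomial (Fin 3) ℂ) :
    (ι → MvPolynomial (Fin 3) ℂ) →ₗ[ℂ] (ι → MvPolynomial (Fin 3) ℂ) :=
  (LinearMap.lsmul (MvPolynomial (Fin 3) ℂ) (ι → MvPolynomial (Fin 3) ℂ) p).restrictScalars ℂ

@[simp] lemma matrixMap_apply (A : Matrix ι ι (MvPolynomial (Fin 3) ℂ))
    (g : ι → MvPolynomial (Fin 3) ℂ) : matrixMap A g = A.mulVec g := rfl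

@[simp] lemma scalarMap_apply {ι : Type*} (p : MvPolynomial (Fin 3) ℂ)
    (g : ι → MvPolynomial (Fin 3) ℂ) : scalarMap ι p g = p • g := rfl

lemma scalarMap_injective {ι : Type*} {p : MvPolynomial (Fin 3) ℂ} (hp : p ≠ 0) :
    Function.Injective (scalarMap ι p) :=
  smul_right_injective _ hp

lemma matrixMap_injective [DecidableEq ι] {A : Matrix ι ι (MvPolynomial (Fin 3) ℂ)}
    (hA : A.det ≠ 0) : Function.Injective (matrixMap A) := by
  rw [injective_iff_map_eq_zero]
  intro g hg
  exact mulVec_injective_of_det_mem_nonZeroDivisors (mem_nonZeroDivisors_of_ne_zero hA) hg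

lemma mulVec_mem_formTuples {A : Matrix ι ι (MvPolynomial (Fin 3) ℂ)} {a d : ℤ}
    (hA : ∀ i j, A i j ∈ forms a) {g : ι → MvPolynomial (Fin 3) ℂ} (hg : g ∈ formTuples ι d) :
    A.mulVec g ∈ formTuples ι (a + d) :=
  mem_formTuples.2 fun i => sum_mem fun j _ => mul_mem_forms (hA i j) (mem_formTuples.1 hg j)

lemma smul_mem_formTuples {ι : Type*} {p : MvPolynomial (Fin 3) ℂ} {n d : ℤ}
    (hp : p ∈ forms n) {g : ι → MvPolynomial (Fin 3) ℂ} (hg : g ∈ formTuples ι d) :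
    p • g ∈ formTuples ι (n + d) :=
  mem_formTuples.2 fun i => mul_mem_forms hp (mem_formTuples.1 hg i)

/-- The component of degree `d` of a tuple of polynomials. -/
def tupleComp {ι : Type*} (d : ℤ) (g : ι → MvPolynomial (Fin 3) ℂ) : ι → MvPolynomial (Fin 3) ℂ :=
  fun i => formComp d (g i)

lemma tupleComp_mem {ι : Type*} (d : ℤ) (g : ι → MvPolynomial (Fin 3) ℂ) :
    tupleComp d g ∈ formTuples ι d :=
  mem_formTuples.2 fun _ => formComp_mem _ _

lemma tupleComp_mulVec {A : Matrix ι ι (MvPolynomial (Fin 3) ℂ)} {a : ℤ}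
    (hA : ∀ i j, A i j ∈ forms a) (d : ℤ) (g : ι → MvPolynomial (Fin 3) ℂ) :
    tupleComp (a + d) (A.mulVec g) = A.mulVec (tupleComp d g) := by
  ext1 i
  simp only [tupleComp, Matrix.mulVec, dotProduct, map_sum]
  exact Finset.sum_congr rfl fun j _ => formComp_mul (hA i j) _

end

/-! ### The Hilbert function of the cokernel of `A` modulo `p`. -/

noncomputable section

variable {ι : Type*} [Fintype ι]

lemma tupleComp_smul {ι : Type*} {p : MvPolynomial (Fin 3) ℂ} {n : ℤ} (hp : p ∈ forms n) (d : ℤ)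
    (g : ι → MvPolynomial (Fin 3) ℂ) : tupleComp (n + d) (p • g) = p • tupleComp d g :=
  funext fun _ => formComp_mul hp _

lemma tupleComp_add {ι : Type*} (d : ℤ) (f g : ι → MvPolynomial (Fin 3) ℂ) :
    tupleComp d (f + g) = tupleComp d f + tupleComp d g :=
  funext fun _ => map_add _ _ _

lemma tupleComp_of_mem {ι : Type*} {d : ℤ} {f : ι → MvPolynomial (Fin 3) ℂ}
    (hf : f ∈ formTuples ι d) : tupleComp d f = f :=
  funext fun i => formComp_of_mem (mem_formTuples.1 hf i)

/-- The part of degree `d` of `A R^ι + p R^ι`, for a matrix `A` of forms of degree `a` and a form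
`p` of degree `n`. -/
def formImage (A : Matrix ι ι (MvPolynomial (Fin 3) ℂ)) (p : MvPolynomial (Fin 3) ℂ)
    (a n d : ℤ) : Submodule ℂ (ι → MvPolynomial (Fin 3) ℂ) :=
  (formTuples ι (d - a)).map (matrixMap A) ⊔ (formTuples ι (d - n)).map (scalarMap ι p)

variable {A : Matrix ι ι (MvPolynomial (Fin 3) ℂ)} {p : MvPolynomial (Fin 3) ℂ} {a n d : ℤ}

lemma mem_formImage {f : ι → MvPolynomial (Fin 3) ℂ} :
    f ∈ formImage A p a n d ↔ ∃ g ∈ formTuples ι (d - a), ∃ h ∈ formTuples ι (d - n),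
      A.mulVec g + p • h = f := by
  simp [formImage, Submodule.mem_sup]

instance : FiniteDimensional ℂ (formImage A p a n d) :=
  inferInstanceAs (FiniteDimensional ℂ
    ((formTuples ι (d - a)).map (matrixMap A) ⊔ (formTuples ι (d - n)).map (scalarMap ι p) :
      Submodule ℂ (ι → MvPolynomial (Fin 3) ℂ)))

lemma formImage_le (hA : ∀ i j, A i j ∈ forms a) (hp : p ∈ forms n) :
    formImage A p a n d ≤ formTuples ι d := by
  intro f hf
  obtain ⟨g, hg, h, hh, rfl⟩ := mem_formImage.1 hf
  have h1 := mulVec_mem_formTuples hA hg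
  have h2 := smul_mem_formTuples hp hh
  rw [add_sub_cancel] at h1 h2
  exact add_mem h1 h2

/-- The witnesses `g` and `h` need not be homogeneous: since `A` and `p` are, taking components of
degree `d` in the equation leaves forms of the right degrees. -/
lemma mem_formImage_of_eq (hA : ∀ i j, A i j ∈ forms a) (hp : p ∈ forms n)
    {f g h : ι → MvPolynomial (Fin 3) ℂ} (hf : f ∈ formTuples ι d)
    (e : A.mulVec g + p • h = f) : f ∈ formImage A p a n d := by
  refine mem_formImage.2 ⟨_, tupleComp_mem _ g, _, tupleComp_mem _ h, ?_⟩
  rw [← tupleComp_mulVec hA, ← tupleComp_smul hp, add_sub_cancel, add_sub_cancel,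
    ← tupleComp_add, e, tupleComp_of_mem hf]

variable [DecidableEq ι]

/-- A common element `A g = p h` is a Koszul relation between `A` and `p`, so by exactness it comes
from a single tuple. -/
lemma map_inf_map_formTuples (hA : ∀ i j, A i j ∈ forms a) (hp : p ∈ forms n)
    (hdet : A.det ≠ 0) (hcop : ∀ u, A.det ∣ p * u → A.det ∣ u) :
    (formTuples ι (d - a)).map (matrixMap A) ⊓ (formTuples ι (d - n)).map (scalarMap ι p)
      = (formTuples ι (d - a - n)).map (scalarMap ι p ∘ₗ matrixMap A) := by
  apply le_antisymm
  · rintro f ⟨⟨g, hg, hgf⟩, ⟨h, hh, rfl⟩⟩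
    have hg' : g ∈ formTuples ι (d - a) := hg
    have hh' : h ∈ formTuples ι (d - n) := hh
    simp only [matrixMap_apply, scalarMap_apply] at hgf
    obtain ⟨h', e1, -⟩ := exists_of_mulVec_add_smul_eq_zero (g := g) (h := -h)
      (mem_nonZeroDivisors_of_ne_zero hdet) hcop (by rw [hgf, smul_neg, add_neg_cancel])
    refine ⟨_, tupleComp_mem _ (-h'), ?_⟩
    simp only [LinearMap.comp_apply, scalarMap_apply, matrixMap_apply]
    rw [← tupleComp_mulVec hA, Matrix.mulVec_neg, ← e1, neg_neg,
      show a + (d - a - n) = d - n by ring, tupleComp_of_mem hh']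
  · rintro f ⟨h, hh, rfl⟩
    have hh' : h ∈ formTuples ι (d - a - n) := hh
    simp only [LinearMap.comp_apply, scalarMap_apply, matrixMap_apply]
    constructor
    · refine ⟨p • h, ?_, by simp [Matrix.mulVec_smul]⟩
      have := smul_mem_formTuples hp hh'
      rwa [add_sub_cancel] at this
    · refine ⟨A.mulVec h, ?_, rfl⟩
      have := mulVec_mem_formTuples hA hh'
      rwa [show a + (d - a - n) = d - n by ring] at this

lemma finrank_map_of_injective {V W : Type*} [AddCommGroup V] [Module ℂ V] [AddCommGroup W]
    [Module ℂ W] {f : V →ₗ[ℂ] W} (hf : Function.Injective f) (U : Submodule ℂ V) :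
    Module.finrank ℂ (U.map f) = Module.finrank ℂ U :=
  (Submodule.equivMapOfInjective f hf U).finrank_eq.symm

/-- The Hilbert function of the cokernel of `A` modulo `p`. -/
lemma finrank_formTuples_eq_finrank_formImage_add (ha : 0 ≤ a) (hn : 0 ≤ n)
    (hA : ∀ i j, A i j ∈ forms a) (hp : p ∈ forms n) (hp0 : p ≠ 0)
    (hdet : A.det ≠ 0) (hcop : ∀ u, A.det ∣ p * u → A.det ∣ u) (hd : a + n ≤ d + 2) :
    (Module.finrank ℂ (formTuples ι d) : ℤ)
      = Module.finrank ℂ (formImage A p a n d) + Fintype.card ι * (a * n) := by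
  have h1 := Submodule.finrank_sup_add_finrank_inf_eq
    ((formTuples ι (d - a)).map (matrixMap A)) ((formTuples ι (d - n)).map (scalarMap ι p))
  rw [map_inf_map_formTuples hA hp hdet hcop, finrank_map_of_injective (matrixMap_injective hdet),
    finrank_map_of_injective (scalarMap_injective hp0), finrank_map_of_injective
      (f := scalarMap ι p ∘ₗ matrixMap A)
      ((scalarMap_injective hp0).comp (matrixMap_injective hdet))] at h1
  -- The dimension formula needs degrees at least `-2`. The lowest one here is `d - a - n`, which is
  -- where `a + n ≤ d + 2` enters.
  have h2 := finrank_formTuples ι (d := d) (by omega)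
  have h3 := finrank_formTuples ι (d := d - a) (by omega)
  have h4 := finrank_formTuples ι (d := d - n) (by omega)
  have h5 := finrank_formTuples ι (d := d - a - n) (by omega)
  change Module.finrank ℂ (formImage A p a n d) + _ = _ at h1
  zify at h1
  -- Inclusion and exclusion: the mixed second difference of `(d + 1)(d + 2)` with steps `a` and `n`
  -- is `2 a n`.
  have : 2 * (Module.finrank ℂ (formTuples ι d) : ℤ)
      = 2 * (Module.finrank ℂ (formImage A p a n d) + Fintype.card ι * (a * n)) := by
    linear_combination h2 + h5 - h3 - h4 - 2 * h1
  omega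

end

noncomputable section

/-! ### Separating points by forms; finiteness of the set of common zeros -/

lemma linear_form_mem_forms (i j : Fin 3) (a b : ℂ) : X i * C a - X j * C b ∈ forms 1 :=
  sub_mem (mul_mem_forms (mem_forms_iff_isHomogeneous.2 (isHomogeneous_X ℂ i))
      (mem_forms_iff_isHomogeneous.2 (isHomogeneous_C _ a)))
    (mul_mem_forms (mem_forms_iff_isHomogeneous.2 (isHomogeneous_X ℂ j))
      (mem_forms_iff_isHomogeneous.2 (isHomogeneous_C _ b)))

lemma exists_linear_form {v w : Fin 3 → ℂ} (hw : w ≠ 0) (h : ∀ c : ℂ, v ≠ c • w) :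
    ∃ l ∈ forms 1, eval w l = 0 ∧ eval v l ≠ 0 := by
  obtain ⟨j, hj⟩ := Function.ne_iff.1 hw
  obtain ⟨i, hi⟩ := Function.ne_iff.1 (h (v j / w j))
  -- The form is a `2 × 2` minor against `w`. It is nonzero at `v` because `i` is a coordinate where
  -- `v` differs from the only multiple of `w` agreeing with it at `j`.
  refine ⟨_, linear_form_mem_forms i j (w j) (w i), by simp [mul_comm], ?_⟩
  simp only [map_sub, map_mul, eval_X, eval_C]
  intro h0
  apply hi
  simp only [Pi.smul_apply, smul_eq_mul]
  rw [Pi.zero_apply] at hj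
  field_simp
  linear_combination h0

/-- Multiply linear forms, one through each point of `s` and none through `w`. The exact degree
matters for the count of common zeros. -/
lemma exists_separating_form {κ : Type*} (s : Finset κ) (v : κ → Fin 3 → ℂ) (w : Fin 3 → ℂ)
    (hv : ∀ i ∈ s, v i ≠ 0) (h : ∀ i ∈ s, ∀ c : ℂ, w ≠ c • v i) :
    ∃ f ∈ forms s.card, (∀ i ∈ s, eval (v i) f = 0) ∧ eval w f ≠ 0 := by
  classical
  have h1 : ∀ i, ∃ l ∈ forms 1, i ∈ s → eval (v i) l = 0 ∧ eval w l ≠ 0 := fun i => by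
    by_cases hi : i ∈ s
    · obtain ⟨l, hl, h2⟩ := exists_linear_form (hv i hi) (h i hi)
      exact ⟨l, hl, fun _ => h2⟩
    · exact ⟨0, zero_mem _, fun h' => absurd h' hi⟩
  choose l hl h2 using h1
  refine ⟨∏ i ∈ s, l i, ?_, fun i hi => ?_, ?_⟩
  · have := IsWeightedHomogeneous.prod s l (fun _ => (1 : ℤ)) (fun i _ => hl i)
    simp only [Finset.sum_const, nsmul_eq_mul, mul_one] at this
    exact this
  · rw [map_prod]
    exact Finset.prod_eq_zero hi (h2 i hi).1
  · rw [map_prod]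
    exact Finset.prod_ne_zero_iff.2 fun i hi => (h2 i hi).2

lemma dvd_of_dvd_mul_of_irreducible {q p : MvPolynomial (Fin 3) ℂ} (hq : Irreducible q)
    (hp : ¬ q ∣ p) (u : MvPolynomial (Fin 3) ℂ) (h : q ∣ p * u) : q ∣ u :=
  (hq.prime.dvd_or_dvd h).resolve_left hp

/-- Weak form of Bezout's theorem. -/
lemma card_le_of_common_zeros {q p : MvPolynomial (Fin 3) ℂ} {a n : ℕ} (hq : q ∈ forms a)
    (hp : p ∈ forms n) (hirr : Irreducible q) (hndvd : ¬ q ∣ p) {d : ℕ} (hd : a + n ≤ d)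
    (v : Fin (d + 1) → Fin 3 → ℂ) (hv0 : ∀ i, v i ≠ 0)
    (hv : ∀ i j, i ≠ j → ∀ c : ℂ, v i ≠ c • v j)
    (hvq : ∀ i, eval (v i) q = 0) (hvp : ∀ i, eval (v i) p = 0) : d + 1 ≤ a * n := by
  -- Regarding `q` as a `1 × 1` matrix makes the Hilbert function count available.
  let A : Matrix Unit Unit (MvPolynomial (Fin 3) ℂ) := fun _ _ => q
  have hdet : A.det = q := Matrix.det_unique A
  have hp0 : p ≠ 0 := fun h => hndvd (h ▸ dvd_zero q)
  have hdim := finrank_formTuples_eq_finrank_formImage_add (A := A) (d := d)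
    (Int.natCast_nonneg a) (Int.natCast_nonneg n) (fun _ _ => hq) hp hp0
    (hdet ▸ hirr.ne_zero) (hdet ▸ dvd_of_dvd_mul_of_irreducible hirr hndvd) (by omega)
  let ev : (Unit → MvPolynomial (Fin 3) ℂ) →ₗ[ℂ] (Fin (d + 1) → ℂ) :=
    LinearMap.pi fun i => (aeval (v i)).toLinearMap ∘ₗ LinearMap.proj ()
  have hev : ∀ f i, ev f i = eval (v i) (f ()) := fun f i => rfl
  have hker : formImage A p a n d ≤ LinearMap.ker ev := by
    intro f hf
    obtain ⟨g, -, h, -, rfl⟩ := mem_formImage.1 hf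
    rw [LinearMap.mem_ker]
    ext i
    simp [hev, Matrix.mulVec, dotProduct, A, hvq, hvp]
  -- A form that separates one of the `d + 1` points from the other `d` has degree exactly `d`. So
  -- evaluation on degree `d` is onto, while it kills a subspace of codimension `a * n`.
  have hsurj : Function.Surjective (ev.domRestrict (formTuples Unit d)) := by
    have h1 : ∀ i, ∃ f ∈ forms d, (∀ j, j ≠ i → eval (v j) f = 0) ∧ eval (v i) f ≠ 0 := by
      intro i
      obtain ⟨f, hf, h1, h2⟩ := exists_separating_form (Finset.univ.erase i) v (v i)
        (fun j _ => hv0 j) (fun j hj => hv i j (Finset.ne_of_mem_erase hj).symm)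
      rw [Finset.card_erase_of_mem (Finset.mem_univ i), Finset.card_univ, Fintype.card_fin] at hf
      exact ⟨f, hf, fun j hj => h1 j (Finset.mem_erase.2 ⟨hj, Finset.mem_univ j⟩), h2⟩
    choose f hf h1 h2 using h1
    intro c
    refine ⟨⟨fun _ => ∑ i, (c i / eval (v i) (f i)) • f i, mem_formTuples.2 fun _ =>
      sum_mem fun i _ => Submodule.smul_mem _ _ (hf i)⟩, ?_⟩
    ext j
    change eval (v j) (∑ i, (c i / eval (v i) (f i)) • f i) = c j
    rw [map_sum, Finset.sum_eq_single j]
    · rw [smul_eval, div_mul_cancel₀ _ (h2 j)]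
    · intro i _ hij
      rw [smul_eval, h1 i j hij.symm, mul_zero]
    · simp
  have h3 := LinearMap.finrank_range_add_finrank_ker (ev.domRestrict (formTuples Unit d))
  rw [LinearMap.range_eq_top.2 hsurj, finrank_top, Module.finrank_fin_fun] at h3
  have hle : formImage A p a n d ≤ formTuples Unit d := formImage_le (fun _ _ => hq) hp
  have h4 : (formImage A p a n d).comap (formTuples Unit d).subtype
      ≤ LinearMap.ker (ev.domRestrict (formTuples Unit d)) := fun f hf => hker hf
  have h5 := Submodule.finrank_mono h4
  rw [(Submodule.comapSubtypeEquivOfLe hle).finrank_eq] at h5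
  simp only [Fintype.card_unit, Nat.cast_one, one_mul] at hdim
  have h6 : ((a * n : ℕ) : ℤ) = a * n := by push_cast; rfl
  zify at h3 h5 ⊢
  linarith

lemma mk_eq_mk_of_eq_smul {v w : Fin 3 → ℂ} (hv : v ≠ 0) (hw : w ≠ 0) {c : ℂ}
    (h : v = c • w) : Projectivization.mk ℂ v hv = Projectivization.mk ℂ w hw :=
  (Projectivization.mk_eq_mk_iff' ℂ v w hv hw).2 ⟨c, h.symm⟩

lemma finite_commonZeros {q p : MvPolynomial (Fin 3) ℂ} {a n : ℕ} (hq : q ∈ forms a)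
    (hp : p ∈ forms n) (hirr : Irreducible q) (hndvd : ¬ q ∣ p) : (commonZeros q p).Finite := by
  by_contra hinf
  have : Infinite (commonZeros q p) := Set.infinite_coe_iff.2 hinf
  -- Here `d = a + n + a * n` is large enough for the count and also gives more than `a * n` points.
  let φ : Fin (a + n + a * n + 1) → commonZeros q p := fun i => Infinite.natEmbedding _ i.1
  have hφ : Function.Injective φ :=
    (Infinite.natEmbedding _).injective.comp Fin.val_injective
  have := card_le_of_common_zeros hq hp hirr hndvd (d := a + n + a * n) (by omega)
    (fun i => (φ i).1.rep) (fun i => (φ i).1.rep_nonzero)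
    (fun i j hij c hc => hij <| hφ <| Subtype.ext <| by
      have h := mk_eq_mk_of_eq_smul (φ i).1.rep_nonzero (φ j).1.rep_nonzero hc
      rwa [Projectivization.mk_rep, Projectivization.mk_rep] at h)
    (fun i => (φ i).2.1) (fun i => (φ i).2.2)
  omega

/-! ### Restriction to a line -/

/-- The linear form `x₀ + t x₁ + t² x₂`. -/
def lineForm (t : ℂ) : MvPolynomial (Fin 3) ℂ := X 0 + C t * X 1 + C (t ^ 2) * X 2

lemma lineForm_mem_forms (t : ℂ) : lineForm t ∈ forms 1 := by
  have h (i : Fin 3) : X i ∈ forms 1 := mem_forms_iff_isHomogeneous.2 (isHomogeneous_X ℂ i)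
  have hC (s : ℂ) (i : Fin 3) : C s * X i ∈ forms 1 := by
    rw [C_mul']
    exact Submodule.smul_mem _ _ (h i)
  exact add_mem (add_mem (h 0) (hC _ _)) (hC _ _)

lemma eval_lineForm (t : ℂ) (v : Fin 3 → ℂ) :
    eval v (lineForm t) = v 0 + t * v 1 + t ^ 2 * v 2 := by
  simp [lineForm]

/-- At a fixed nonzero point the value of `lineForm t` is a nonzero polynomial in `t`, whose
coefficients are the coordinates of the point. A finite product of such polynomials has a non-root.
-/
lemma exists_lineForm_ne_zero {κ : Type*} [Finite κ] (v : κ → Fin 3 → ℂ) (hv : ∀ i, v i ≠ 0) :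
    ∃ t, ∀ i, eval (v i) (lineForm t) ≠ 0 := by
  have := Fintype.ofFinite κ
  let P : κ → Polynomial ℂ := fun i =>
    Polynomial.C (v i 0) + Polynomial.C (v i 1) * Polynomial.X
      + Polynomial.C (v i 2) * Polynomial.X ^ 2
  have hP : ∀ i, P i ≠ 0 := fun i h => hv i <| by
    have h0 := congrArg (fun q => Polynomial.coeff q 0) h
    have h1 := congrArg (fun q => Polynomial.coeff q 1) h
    have h2 := congrArg (fun q => Polynomial.coeff q 2) h
    simp [P, Polynomial.coeff_X, Polynomial.coeff_C, Polynomial.coeff_X_pow] at h0 h1 h2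
    ext j
    fin_cases j <;> simpa
  have hprod : ∏ i, P i ≠ 0 := Finset.prod_ne_zero_iff.2 fun i _ => hP i
  obtain ⟨t, ht⟩ : ∃ t, (∏ i, P i).eval t ≠ 0 := by
    by_contra! h
    exact hprod (Polynomial.funext fun t => by simpa using h t)
  refine ⟨t, fun i => ?_⟩
  rw [Polynomial.eval_prod] at ht
  have := Finset.prod_ne_zero_iff.1 ht i (Finset.mem_univ i)
  rw [eval_lineForm]
  convert! this using 1
  simp [P]
  ring

/-- Restriction of a polynomial to the plane `x₀ + t x₁ + t² x₂ = 0`. -/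
def planeRestrict (t : ℂ) : MvPolynomial (Fin 3) ℂ →ₐ[ℂ] MvPolynomial (Fin 2) ℂ :=
  aeval ![-(C t * X 0 + C (t ^ 2) * X 1), X 0, X 1]

/-- A section of the restriction map. -/
def planeExtend : MvPolynomial (Fin 2) ℂ →ₐ[ℂ] MvPolynomial (Fin 3) ℂ := aeval ![X 1, X 2]

lemma planeRestrict_planeExtend (t : ℂ) (f : MvPolynomial (Fin 2) ℂ) :
    planeRestrict t (planeExtend f) = f := by
  have : (planeRestrict t).comp planeExtend = AlgHom.id ℂ _ := by
    ext i
    fin_cases i <;> simp [planeRestrict, planeExtend]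
  exact DFunLike.congr_fun this f

lemma planeRestrict_lineForm (t : ℂ) : planeRestrict t (lineForm t) = 0 := by
  simp [planeRestrict, lineForm, ← algebraMap_eq]

/-- Modulo `lineForm t` the first variable is a combination of the other two, so restricting and
extending again is the identity modulo `lineForm t`. -/
lemma lineForm_dvd_of_planeRestrict_eq_zero {t : ℂ} {f : MvPolynomial (Fin 3) ℂ}
    (h : planeRestrict t f = 0) : lineForm t ∣ f := by
  rw [← Ideal.mem_span_singleton, ← Ideal.Quotient.eq_zero_iff_mem]
  have h1 : ((Ideal.Quotient.mkₐ ℂ (Ideal.span {lineForm t})).comp planeExtend).comp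
      (planeRestrict t) = Ideal.Quotient.mkₐ ℂ (Ideal.span {lineForm t}) := by
    ext i
    simp only [AlgHom.comp_apply, Ideal.Quotient.mkₐ_eq_mk]
    rw [Ideal.Quotient.eq, Ideal.mem_span_singleton]
    fin_cases i
    · refine ⟨-1, ?_⟩
      simp [planeRestrict, planeExtend, lineForm, ← algebraMap_eq]
      ring
    · simp [planeRestrict, planeExtend]
    · simp [planeRestrict, planeExtend]
  have h2 := DFunLike.congr_fun h1 f
  simp only [AlgHom.comp_apply, h, map_zero, Ideal.Quotient.mkₐ_eq_mk] at h2
  exact h2.symm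

lemma eval_planeRestrict (t : ℂ) (w : Fin 2 → ℂ) (f : MvPolynomial (Fin 3) ℂ) :
    eval w (planeRestrict t f) = eval ![-(t * w 0 + t ^ 2 * w 1), w 0, w 1] f := by
  have : (aeval w).comp (planeRestrict t)
      = (aeval ![-(t * w 0 + t ^ 2 * w 1), w 0, w 1] : MvPolynomial (Fin 3) ℂ →ₐ[ℂ] ℂ) := by
    ext i
    fin_cases i <;> simp [planeRestrict, ← algebraMap_eq]
  exact DFunLike.congr_fun this f

/-- A common factor of the restrictions can vanish only at the origin, since the line misses all
common zeros. By the Nullstellensatz it divides a power of each variable, and these powers are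
coprime. -/
lemma isRelPrime_planeRestrict {q p : MvPolynomial (Fin 3) ℂ} {t : ℂ}
    (h : ∀ v : Fin 3 → ℂ, v ≠ 0 → eval v q = 0 → eval v p = 0 → eval v (lineForm t) ≠ 0) :
    IsRelPrime (planeRestrict t q) (planeRestrict t p) := by
  intro r hr1 hr2
  have hz : ∀ w : Fin 2 → ℂ, eval w r = 0 → w = 0 := by
    intro w hw
    obtain ⟨s1, hs1⟩ := hr1
    obtain ⟨s2, hs2⟩ := hr2
    by_contra hw0
    refine h ![-(t * w 0 + t ^ 2 * w 1), w 0, w 1] ?_ ?_ ?_ ?_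
    · intro h0
      apply hw0
      have h1 := congrFun h0 1
      have h2 := congrFun h0 2
      ext i
      fin_cases i
      · simpa using h1
      · simpa using h2
    · rw [← eval_planeRestrict, hs1, map_mul, hw, zero_mul]
    · rw [← eval_planeRestrict, hs2, map_mul, hw, zero_mul]
    · rw [eval_lineForm]
      simp
  have hrad : ∀ i : Fin 2, ∃ k, r ∣ X i ^ k := by
    intro i
    have : (X i : MvPolynomial (Fin 2) ℂ) ∈ (Ideal.span {r}).radical := by
      rw [← vanishingIdeal_zeroLocus_eq_radical (K := ℂ)]
      rw [mem_vanishingIdeal_iff]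
      intro w hw
      rw [mem_zeroLocus_iff] at hw
      have := hz w (by simpa using hw r (Ideal.mem_span_singleton_self r))
      simp [this]
    obtain ⟨k, hk⟩ := this
    exact ⟨k, Ideal.mem_span_singleton.1 hk⟩
  obtain ⟨k, hk⟩ := hrad 0
  obtain ⟨l, hl⟩ := hrad 1
  have hX : IsRelPrime (X 0 : MvPolynomial (Fin 2) ℂ) (X 1) := by
    rw [(X_prime (R := ℂ) (i := (0 : Fin 2))).irreducible.isRelPrime_iff_not_dvd]
    intro hdvd
    rw [X_dvd_X] at hdvd
    simp at hdvd
  exact (hX.pow (m := k) (n := l)) hk hl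

/-- Otherwise coprimality would make the restriction of `p` a unit, but a form of positive degree
vanishes at the origin. -/
lemma planeRestrict_ne_zero {q p : MvPolynomial (Fin 3) ℂ} {t : ℂ} {n : ℕ} (hn : n ≠ 0)
    (hp : p ∈ forms n) (h : IsRelPrime (planeRestrict t q) (planeRestrict t p)) :
    planeRestrict t q ≠ 0 := by
  intro h0
  rw [h0, isRelPrime_zero_left] at h
  have h1 := h.map (eval (0 : Fin 2 → ℂ))
  rw [eval_planeRestrict] at h1
  have h2 := eval_smul_of_mem_forms hp 0 0
  rw [zero_pow hn, zero_mul, zero_smul] at h2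
  have h3 : ![-(t * (0 : Fin 2 → ℂ) 0 + t ^ 2 * (0 : Fin 2 → ℂ) 1), (0 : Fin 2 → ℂ) 0,
      (0 : Fin 2 → ℂ) 1] = 0 := by
    ext i
    fin_cases i <;> simp
  rw [h3, h2] at h1
  exact h1.ne_zero rfl

end

noncomputable section

/-! ### Passing to the affine chart `x₀ + t x₁ + t² x₂ = 1` -/

variable {ι : Type*} [Fintype ι] [DecidableEq ι] {A : Matrix ι ι (MvPolynomial (Fin 3) ℂ)}
  {p : MvPolynomial (Fin 3) ℂ} {t : ℂ}

lemma exists_eq_smul_lineForm {ι : Type*} {f : ι → MvPolynomial (Fin 3) ℂ}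
    (h : ∀ i, planeRestrict t (f i) = 0) : ∃ g, f = lineForm t • g := by
  choose g hg using fun i => lineForm_dvd_of_planeRestrict_eq_zero (h i)
  exact ⟨g, funext hg⟩

lemma lineForm_ne_zero (t : ℂ) : lineForm t ≠ 0 := by
  intro h
  have := eval_lineForm t ![1, 0, 0]
  rw [h] at this
  simp at this

/-- The linear form is a nonzerodivisor on the cokernel of `A` modulo `p`. -/
lemma exists_of_lineForm_smul_eq (hrel : IsRelPrime (planeRestrict t A.det) (planeRestrict t p))
    (h0 : planeRestrict t A.det ≠ 0) {f g h : ι → MvPolynomial (Fin 3) ℂ}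
    (e : lineForm t • f = A.mulVec g + p • h) : ∃ g' h', f = A.mulVec g' + p • h' := by
  have hdet : (A.map (planeRestrict t)).det = planeRestrict t A.det :=
    (AlgHom.map_det (planeRestrict t) A).symm
  have hπ (M : ι → MvPolynomial (Fin 3) ℂ) (i : ι) : planeRestrict t (A.mulVec M i)
      = (A.map (planeRestrict t)).mulVec (fun j => planeRestrict t (M j)) i := by
    simp [Matrix.mulVec, dotProduct]
  have e1 : (A.map (planeRestrict t)).mulVec (fun j => planeRestrict t (g j))
      + planeRestrict t p • (fun j => planeRestrict t (h j)) = 0 := by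
    ext1 i
    have := congrArg (planeRestrict t) (congrFun e i)
    simp only [Pi.smul_apply, Pi.add_apply, smul_eq_mul, map_mul, map_add,
      planeRestrict_lineForm, zero_mul] at this ⊢
    rw [← hπ, ← this, Pi.zero_apply]
  -- On the plane `lineForm t = 0` the relation becomes a Koszul relation over two variables, so
  -- exactness applies. Lifting the witness `h₁` and correcting `g` and `h` by the resulting trivial
  -- relation makes both divisible by `lineForm t`, which is then cancelled.
  obtain ⟨h₁, e2, e3⟩ := exists_of_mulVec_add_smul_eq_zero
    (hdet ▸ mem_nonZeroDivisors_of_ne_zero h0)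
    (fun u hu => by
      rw [hdet] at hu ⊢
      exact hrel.dvd_of_dvd_mul_left hu) e1
  obtain ⟨h'', e4⟩ := exists_eq_smul_lineForm (t := t)
    (f := h - A.mulVec (fun j => planeExtend (h₁ j))) (fun i => by
      rw [Pi.sub_apply, map_sub, hπ, sub_eq_zero]
      simp only [planeRestrict_planeExtend]
      exact congrFun e2 i)
  obtain ⟨g'', e5⟩ := exists_eq_smul_lineForm (t := t)
    (f := g + p • (fun j => planeExtend (h₁ j))) (fun i => by
      have := congrFun e3 i
      simp only [Pi.neg_apply, Pi.smul_apply, smul_eq_mul] at this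
      simp only [Pi.add_apply, Pi.smul_apply, smul_eq_mul, map_add, map_mul,
        planeRestrict_planeExtend, this, neg_add_cancel])
  refine ⟨g'', h'', smul_right_injective _ (lineForm_ne_zero t) ?_⟩
  dsimp only
  rw [e, smul_add, ← Matrix.mulVec_smul, ← e5, smul_comm (lineForm t) p, ← e4,
    Matrix.mulVec_add, Matrix.mulVec_smul, smul_sub]
  abel

lemma exists_of_lineForm_pow_smul_eq
    (hrel : IsRelPrime (planeRestrict t A.det) (planeRestrict t p))
    (h0 : planeRestrict t A.det ≠ 0) (k : ℕ) {f g h : ι → MvPolynomial (Fin 3) ℂ}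
    (e : lineForm t ^ k • f = A.mulVec g + p • h) : ∃ g' h', f = A.mulVec g' + p • h' := by
  induction k generalizing g h with
  | zero => exact ⟨g, h, by rw [← e, pow_zero, one_smul]⟩
  | succ k ih =>
    rw [pow_succ', mul_smul] at e
    obtain ⟨g', h', e'⟩ := exists_of_lineForm_smul_eq hrel h0 e
    exact ih e'

variable {a n : ℕ}

/-- Multiplication by `lineForm t` is injective on the cokernel, and the Hilbert function takes the
same value in degrees `d - 1` and `d`, so it is also surjective. The bound on `d` puts `d - 1` in
the stable range. -/
lemma formTuples_le_formImage_sup_map (hA : ∀ i j, A i j ∈ forms a) (hp : p ∈ forms n)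
    (hirr : Irreducible A.det) (hndvd : ¬ A.det ∣ p)
    (hrel : IsRelPrime (planeRestrict t A.det) (planeRestrict t p))
    (h0 : planeRestrict t A.det ≠ 0) {d : ℤ} (hd : a + n ≤ d + 1) :
    formTuples ι d ≤
      formImage A p a n d ⊔ (formTuples ι (d - 1)).map (scalarMap ι (lineForm t)) := by
  have hp0 : p ≠ 0 := fun h => hndvd (h ▸ dvd_zero _)
  have hcop := dvd_of_dvd_mul_of_irreducible hirr hndvd
  have e1 := finrank_formTuples_eq_finrank_formImage_add (Int.natCast_nonneg a)
    (Int.natCast_nonneg n) hA hp hp0 hirr.ne_zero hcop (d := d) (by omega)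
  have e2 := finrank_formTuples_eq_finrank_formImage_add (Int.natCast_nonneg a)
    (Int.natCast_nonneg n) hA hp hp0 hirr.ne_zero hcop (d := d - 1) (by omega)
  have e3 := Submodule.finrank_sup_add_finrank_inf_eq (formImage A p a n d)
    ((formTuples ι (d - 1)).map (scalarMap ι (lineForm t)))
  have hinf : formImage A p a n d ⊓ (formTuples ι (d - 1)).map (scalarMap ι (lineForm t))
      ≤ (formImage A p a n (d - 1)).map (scalarMap ι (lineForm t)) := by
    rintro x ⟨h1, f, hf, rfl⟩
    obtain ⟨g, -, h, -, e⟩ := mem_formImage.1 h1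
    obtain ⟨g', h', e'⟩ := exists_of_lineForm_smul_eq hrel h0 e.symm
    exact ⟨f, mem_formImage_of_eq hA hp hf e'.symm, rfl⟩
  have e4 := Submodule.finrank_mono hinf
  rw [finrank_map_of_injective (scalarMap_injective (lineForm_ne_zero t))] at e3 e4
  refine (Submodule.eq_of_le_of_finrank_le (sup_le (formImage_le hA hp) ?_) ?_).ge
  · rintro x ⟨f, hf, rfl⟩
    have := smul_mem_formTuples (lineForm_mem_forms t) hf
    rwa [add_sub_cancel] at this
  · zify at e3 e4 ⊢
    linarith

/-- Every tuple of polynomials is congruent to a tuple of forms of degree `d` on the chart. -/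
lemma exists_formTuple_congr (hA : ∀ i j, A i j ∈ forms a) (hp : p ∈ forms n)
    (hirr : Irreducible A.det) (hndvd : ¬ A.det ∣ p)
    (hrel : IsRelPrime (planeRestrict t A.det) (planeRestrict t p))
    (h0 : planeRestrict t A.det ≠ 0) {d : ℕ} (hd : a + n ≤ d + 2)
    (f : ι → MvPolynomial (Fin 3) ℂ) :
    ∃ f₀ ∈ formTuples ι d, ∃ g h c, f = f₀ + A.mulVec g + p • h + (lineForm t - 1) • c := by
  let T : Submodule ℂ (ι → MvPolynomial (Fin 3) ℂ) :=
    formTuples ι d ⊔ LinearMap.range (matrixMap A) ⊔ LinearMap.range (scalarMap ι p)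
      ⊔ LinearMap.range (scalarMap ι (lineForm t - 1))
  have hd0 : formTuples ι d ≤ T := le_sup_left.trans (le_sup_left.trans le_sup_left)
  have hT1 : LinearMap.range (matrixMap A) ≤ T :=
    le_sup_right.trans (le_sup_left.trans le_sup_left)
  have hT2 : LinearMap.range (scalarMap ι p) ≤ T := le_sup_right.trans le_sup_left
  have hT3 : ∀ c, (lineForm t - 1) • c ∈ T := fun c =>
    (le_sup_right : LinearMap.range (scalarMap ι (lineForm t - 1)) ≤ T) ⟨c, rfl⟩
  -- Low degrees are raised to `d` by powers of the linear form, which is `1` on the chart.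
  have hlow : ∀ j ≤ d, formTuples ι j ≤ T := by
    intro j hj f hf
    have h1 : lineForm t ^ (d - j) • f ∈ formTuples ι d := by
      have := smul_mem_formTuples (pow_mem_forms (lineForm_mem_forms t) (d - j)) hf
      rwa [show ((d - j : ℕ) : ℤ) * 1 + j = d by omega] at this
    obtain ⟨c, hc⟩ : lineForm t - 1 ∣ lineForm t ^ (d - j) - 1 := by
      simpa using sub_dvd_pow_sub_pow (lineForm t) 1 (d - j)
    have h2 : f = lineForm t ^ (d - j) • f - (lineForm t - 1) • (c • f) := by
      rw [smul_smul, ← hc, sub_smul, one_smul, sub_sub_cancel]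
    rw [h2]
    exact sub_mem (hd0 h1) (hT3 _)
  -- High degrees descend one at a time: modulo `A` and `p`, a tuple is divisible by the linear
  -- form, which again is `1` on the chart.
  have hhigh : ∀ k : ℕ, formTuples ι (d + k : ℕ) ≤ T := by
    intro k
    induction k with
    | zero => exact hd0
    | succ k ih =>
      refine (formTuples_le_formImage_sup_map hA hp hirr hndvd hrel h0
        (by push_cast; omega)).trans (sup_le (sup_le ?_ ?_) ?_)
      · rintro _ ⟨g, -, rfl⟩
        exact hT1 ⟨g, rfl⟩
      · rintro _ ⟨g, -, rfl⟩
        exact hT2 ⟨g, rfl⟩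
      · rintro _ ⟨g, hg, rfl⟩
        have hg' : g ∈ formTuples ι (d + k : ℕ) := by
          rw [show ((d + (k + 1) : ℕ) : ℤ) - 1 = (d + k : ℕ) by push_cast; ring] at hg
          exact hg
        have : scalarMap ι (lineForm t) g = g + (lineForm t - 1) • g := by
          rw [scalarMap_apply, sub_smul, one_smul, add_sub_cancel]
        rw [this]
        exact add_mem (ih hg') (hT3 g)
  have htop : f ∈ T := by
    have : (⊤ : Submodule ℂ (ι → MvPolynomial (Fin 3) ℂ)) ≤ T := by
      rw [← iSup_formTuples]
      refine iSup_le fun j => ?_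
      rcases le_total j d with hj | hj
      · exact hlow j hj
      · obtain ⟨k, rfl⟩ := Nat.exists_eq_add_of_le hj
        exact hhigh k
    exact this trivial
  obtain ⟨x, hx, _, ⟨c, rfl⟩, e1⟩ := Submodule.mem_sup.1 htop
  obtain ⟨y, hy, _, ⟨h, rfl⟩, e2⟩ := Submodule.mem_sup.1 hx
  obtain ⟨f₀, hf₀, _, ⟨g, rfl⟩, e3⟩ := Submodule.mem_sup.1 hy
  exact ⟨f₀, hf₀, g, h, c, by rw [← e1, ← e2, ← e3]; rfl⟩

/-! ### The coordinate ring of the intersection on the chart. -/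

/-- The ideal of the common zeros of `q` and `p` in the chart. -/
def chartIdeal (q p : MvPolynomial (Fin 3) ℂ) (t : ℂ) : Ideal (MvPolynomial (Fin 3) ℂ) :=
  Ideal.span {q, p, lineForm t - 1}

lemma mem_chartIdeal {q p f : MvPolynomial (Fin 3) ℂ} :
    f ∈ chartIdeal q p t ↔ ∃ u v w, f = q * u + p * v + (lineForm t - 1) * w := by
  rw [chartIdeal, Ideal.mem_span_insert]
  constructor
  · rintro ⟨u, z, hz, rfl⟩
    obtain ⟨v, z', hz', rfl⟩ := Ideal.mem_span_insert.1 hz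
    obtain ⟨w, rfl⟩ := Ideal.mem_span_singleton'.1 hz'
    exact ⟨u, v, w, by ring⟩
  · rintro ⟨u, v, w, rfl⟩
    exact ⟨u, p * v + (lineForm t - 1) * w, Ideal.mem_span_insert.2
      ⟨v, _, Ideal.mem_span_singleton'.2 ⟨w, rfl⟩, by ring⟩, by ring⟩

/-- A form in the ideal of the chart is in the homogeneous ideal up to a power of the linear
form. -/
lemma exists_lineForm_pow_mul_mem {q p f : MvPolynomial (Fin 3) ℂ} {d : ℕ} (hq : q ∈ forms a)
    (hp : p ∈ forms n) (hf : f ∈ forms d) (h : f ∈ chartIdeal q p t) :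
    ∃ k u v, lineForm t ^ k * f = q * u + p * v := by
  obtain ⟨u, v, w, e⟩ := mem_chartIdeal.1 h
  let S := Localization.Away (lineForm t)
  let b : S := IsLocalization.Away.invSelf (lineForm t)
  have hb : algebraMap _ S (lineForm t) * b = 1 := IsLocalization.Away.mul_invSelf _
  -- Homogenization: dividing every variable by `lineForm t` kills `lineForm t - 1` and multiplies a
  -- form of degree `k` by the `k`-th power of the inverse.
  let φ : MvPolynomial (Fin 3) ℂ →ₐ[ℂ] S := aeval fun i =>
    b * algebraMap (MvPolynomial (Fin 3) ℂ) S (X i)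
  have hφ : ∀ {k : ℕ} {g : MvPolynomial (Fin 3) ℂ}, g ∈ forms k →
      φ g = b ^ k * algebraMap _ S g := by
    intro k g hg
    have h1 := aeval_smul_of_mem_forms hg b
      (fun i => algebraMap (MvPolynomial (Fin 3) ℂ) S (X i))
    rw [show aeval (fun i => algebraMap (MvPolynomial (Fin 3) ℂ) S (X i)) g
      = algebraMap _ S g from by
        have h2 : aeval (fun i => algebraMap (MvPolynomial (Fin 3) ℂ) S (X i))
            = IsScalarTower.toAlgHom ℂ (MvPolynomial (Fin 3) ℂ) S := by
          ext i
          simp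
        rw [h2]
        rfl] at h1
    exact h1
  have hL : φ (lineForm t) = 1 := by
    rw [hφ (k := 1) (lineForm_mem_forms t), pow_one, mul_comm, hb]
  have e1 := congrArg φ e
  simp only [map_add, map_mul, map_sub, hL, map_one, sub_self, zero_mul, add_zero, hφ hq, hφ hp,
    hφ hf] at e1
  have hunit : algebraMap _ S (lineForm t) ^ d * b ^ d = 1 := by
    rw [← mul_pow, hb, one_pow]
  have h1 : algebraMap _ S f ∈ (Ideal.span {q, p}).map (algebraMap _ S) := by
    have : algebraMap _ S f = algebraMap _ S (lineForm t) ^ d * (b ^ d * algebraMap _ S f) := by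
      rw [← mul_assoc, hunit, one_mul]
    rw [this, e1]
    refine Ideal.mul_mem_left _ _ (add_mem ?_ ?_)
    · exact Ideal.mul_mem_right _ _ (Ideal.mul_mem_left _ _
        (Ideal.mem_map_of_mem _ (Ideal.subset_span (by simp))))
    · exact Ideal.mul_mem_right _ _ (Ideal.mul_mem_left _ _
        (Ideal.mem_map_of_mem _ (Ideal.subset_span (by simp))))
  rw [IsLocalization.algebraMap_mem_map_algebraMap_iff (Submonoid.powers (lineForm t))] at h1
  obtain ⟨_, ⟨k, rfl⟩, h2⟩ := h1
  obtain ⟨u', v', e2⟩ := Ideal.mem_span_pair.1 h2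
  exact ⟨k, u', v', by rw [mul_comm q, mul_comm p, e2]⟩

/-- The affine coordinate ring of the common zeros of `q` and `p` has the dimension given by
Bezout's theorem. -/
lemma finrank_quotient_chartIdeal {q p : MvPolynomial (Fin 3) ℂ} (ha : a ≠ 0) (hn : n ≠ 0)
    (hq : q ∈ forms a) (hp : p ∈ forms n) (hirr : Irreducible q) (hndvd : ¬ q ∣ p)
    (hrel : IsRelPrime (planeRestrict t q) (planeRestrict t p)) :
    FiniteDimensional ℂ (MvPolynomial (Fin 3) ℂ ⧸ chartIdeal q p t) ∧
    Module.finrank ℂ (MvPolynomial (Fin 3) ℂ ⧸ chartIdeal q p t) = a * n := by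
  have h0 := planeRestrict_ne_zero hn hp hrel
  let A : Matrix Unit Unit (MvPolynomial (Fin 3) ℂ) := fun _ _ => q
  have hA : ∀ i j, A i j ∈ forms a := fun _ _ => hq
  have hdet : A.det = q := Matrix.det_unique A
  have hmul : ∀ g, A.mulVec g = fun _ => q * g () := fun g => by
    ext1 i
    simp [Matrix.mulVec, dotProduct, A]
  have hp0 : p ≠ 0 := fun h => hndvd (h ▸ dvd_zero q)
  -- This is the least degree in the stable range; it is a natural number because `a` and `n` are
  -- positive.
  obtain ⟨d, hd⟩ : ∃ d, d + 2 = a + n := ⟨a + n - 2, by omega⟩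
  have hdim := finrank_formTuples_eq_finrank_formImage_add (A := A) (d := d)
    (Int.natCast_nonneg a) (Int.natCast_nonneg n) hA hp hp0
    (hdet ▸ hirr.ne_zero) (hdet ▸ dvd_of_dvd_mul_of_irreducible hirr hndvd) (by omega)
  let ψ : (Unit → MvPolynomial (Fin 3) ℂ) →ₗ[ℂ] (MvPolynomial (Fin 3) ℂ ⧸ chartIdeal q p t) :=
    (Ideal.Quotient.mkₐ ℂ (chartIdeal q p t)).toLinearMap ∘ₗ LinearMap.proj ()
  have hψ : ∀ f, ψ f = Ideal.Quotient.mk _ (f ()) := fun f => rfl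
  have hsurj : Function.Surjective (ψ.domRestrict (formTuples Unit d)) := by
    intro y
    obtain ⟨f, rfl⟩ := Ideal.Quotient.mk_surjective y
    obtain ⟨f₀, hf₀, g, h, c, e⟩ := exists_formTuple_congr (A := A) (t := t) hA hp
      (hdet ▸ hirr) (hdet ▸ hndvd) (hdet ▸ hrel) (hdet ▸ h0) hd.ge (fun _ => f)
    refine ⟨⟨f₀, hf₀⟩, ?_⟩
    rw [LinearMap.domRestrict_apply, hψ, eq_comm, Ideal.Quotient.eq, mem_chartIdeal]
    refine ⟨g (), h (), c (), ?_⟩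
    have := congrFun e ()
    simp only [Pi.add_apply, hmul, Pi.smul_apply, smul_eq_mul] at this
    linear_combination this
  have hker : LinearMap.ker (ψ.domRestrict (formTuples Unit d))
      = (formImage A p a n d).comap (formTuples Unit d).subtype := by
    ext ⟨f, hf⟩
    rw [LinearMap.mem_ker, LinearMap.domRestrict_apply, hψ, Ideal.Quotient.eq_zero_iff_mem,
      Submodule.mem_comap]
    constructor
    · intro hmem
      -- Membership on the chart gives homogeneous membership only up to a power of the linear form,
      -- which can be cancelled since it is a nonzerodivisor on the cokernel.
      obtain ⟨k, u, v, e⟩ := exists_lineForm_pow_mul_mem hq hp (mem_formTuples.1 hf ()) hmem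
      obtain ⟨g, h, e'⟩ := exists_of_lineForm_pow_smul_eq (A := A) (p := p) (f := f)
        (g := fun _ => u) (h := fun _ => v) (hdet ▸ hrel) (hdet ▸ h0) k (by
          rw [hmul]
          exact funext fun _ => e)
      exact mem_formImage_of_eq hA hp hf e'.symm
    · intro hmem
      obtain ⟨g, -, h, -, e⟩ := mem_formImage.1 hmem
      refine mem_chartIdeal.2 ⟨g (), h (), 0, ?_⟩
      rw [hmul] at e
      have := congrFun e ()
      simp only [Pi.add_apply, Pi.smul_apply, smul_eq_mul, Submodule.subtype_apply] at this
      linear_combination -this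
  have hfd := Module.Finite.of_surjective _ hsurj
  refine ⟨hfd, ?_⟩
  have h3 := LinearMap.finrank_range_add_finrank_ker (ψ.domRestrict (formTuples Unit d))
  rw [LinearMap.range_eq_top.2 hsurj, finrank_top, hker,
    (Submodule.comapSubtypeEquivOfLe (formImage_le hA hp)).finrank_eq] at h3
  simp only [Fintype.card_unit, Nat.cast_one, one_mul] at hdim
  zify at h3 ⊢
  linarith

end

noncomputable section

/-! ### Linear independence of Vandermonde vectors -/

section Evaluation

variable {ι : Type*} [Fintype ι] [DecidableEq ι] {A : Matrix ι ι (MvPolynomial (Fin 3) ℂ)}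
  {p : MvPolynomial (Fin 3) ℂ} {t : ℂ} {a n d : ℕ} {κ : Type*} [Fintype κ]

/-- Test on a tuple with one nonzero entry, a polynomial that vanishes at all the points but one. -/
lemma eq_zero_of_sum_eval_eq_zero (v : κ → Fin 3 → ℂ) (hv0 : ∀ x, v x ≠ 0)
    (hv : ∀ x y, x ≠ y → ∀ c : ℂ, v x ≠ c • v y) (e : κ → ι → ℂ)
    (h : ∀ f : ι → MvPolynomial (Fin 3) ℂ, ∑ x, ∑ i, eval (v x) (f i) * e x i = 0) : e = 0 := by
  classical
  ext x i
  obtain ⟨g, -, h1, h2⟩ := exists_separating_form (Finset.univ.erase x) v (v x)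
    (fun j _ => hv0 j) (fun j hj => hv x j (Finset.ne_of_mem_erase hj).symm)
  have h3 := h (Pi.single i g)
  rw [Finset.sum_eq_single x, Finset.sum_eq_single i] at h3
  · rw [Pi.single_eq_same] at h3
    exact (mul_eq_zero.1 h3).resolve_left h2
  · intro j _ hj
    simp [hj]
  · simp
  · intro y _ hy
    refine Finset.sum_eq_zero fun j _ => ?_
    by_cases hj : j = i
    · subst hj
      rw [Pi.single_eq_same, h1 y (by simp [hy]), zero_mul]
    · simp [hj]
  · simp

/-- A combination of evaluations at the common zeros along left kernel vectors that vanishes on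
the forms of a critical degree is trivial. -/
lemma eq_zero_of_sum_eval_formTuples_eq_zero
    (hA : ∀ i j, A i j ∈ forms a) (hp : p ∈ forms n)
    (hirr : Irreducible A.det) (hndvd : ¬ A.det ∣ p)
    (hrel : IsRelPrime (planeRestrict t A.det) (planeRestrict t p))
    (h0 : planeRestrict t A.det ≠ 0) (hd : a + n ≤ d + 2)
    (v : κ → Fin 3 → ℂ) (hL : ∀ x, eval (v x) (lineForm t) ≠ 0)
    (hv : ∀ x y, x ≠ y → ∀ c : ℂ, v x ≠ c • v y) (hvp : ∀ x, eval (v x) p = 0)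
    (e : κ → ι → ℂ) (he : ∀ x j, ∑ i, eval (v x) (A i j) * e x i = 0)
    (h : ∀ f ∈ formTuples ι d, ∑ x, ∑ i, eval (v x) (f i) * e x i = 0) : e = 0 := by
  have hv0 : ∀ x, v x ≠ 0 := fun x hx => hL x <| by rw [hx, eval_lineForm]; simp
  -- Rescale the points into the chart where the linear form is `1`. The factor `s x ^ d` in `e'`
  -- compensates for this on forms of degree `d`.
  let s : κ → ℂ := fun x => eval (v x) (lineForm t)
  let v' : κ → Fin 3 → ℂ := fun x => (s x)⁻¹ • v x
  let e' : κ → ι → ℂ := fun x => s x ^ d • e x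
  have hs : ∀ x, s x ≠ 0 := hL
  have hv' : ∀ {k : ℕ} {f : MvPolynomial (Fin 3) ℂ}, f ∈ forms k → ∀ x,
      eval (v' x) f = (s x)⁻¹ ^ k * eval (v x) f :=
    fun hf x => eval_smul_of_mem_forms hf _ _
  have key : e' = 0 := by
    refine eq_zero_of_sum_eval_eq_zero v' (fun x => smul_ne_zero (inv_ne_zero (hs x)) (hv0 x))
      (fun x y hxy c hc => hv x y hxy (s x * (c * (s y)⁻¹)) ?_) e' fun f => ?_
    · rw [mul_smul, mul_smul, ← hc, smul_inv_smul₀ (hs x)]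
    -- The functional extends from degree `d` to all tuples: in the congruence the term with `A`
    -- dies because `e x` is a left kernel vector, and the other two because `p` and `lineForm t -
    -- 1` vanish at the rescaled points.
    · obtain ⟨f₀, hf₀, g, h', c, rfl⟩ :=
        exists_formTuple_congr (t := t) hA hp hirr hndvd hrel h0 hd f
      rw [← h f₀ hf₀]
      refine Finset.sum_congr rfl fun x _ => ?_
      have h1 : ∀ i, eval (v' x) (f₀ i) * e' x i = eval (v x) (f₀ i) * e x i := fun i => by
        rw [hv' (mem_formTuples.1 hf₀ i)]
        simp only [e', Pi.smul_apply, smul_eq_mul]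
        rw [inv_pow]
        have := hs x
        field_simp
      have h2 : ∑ i, eval (v' x) (A.mulVec g i) * e' x i = 0 := by
        have : ∀ i, eval (v' x) (A.mulVec g i) * e' x i
            = ∑ j, (eval (v' x) (g j) * ((s x)⁻¹ ^ a * s x ^ d))
              * (eval (v x) (A i j) * e x i) := by
          intro i
          simp only [Matrix.mulVec, dotProduct, map_sum, map_mul, Finset.sum_mul]
          refine Finset.sum_congr rfl fun j _ => ?_
          rw [hv' (hA i j)]
          simp only [e', Pi.smul_apply, smul_eq_mul]
          ring
        simp_rw [this]
        rw [Finset.sum_comm]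
        refine Finset.sum_eq_zero fun j _ => ?_
        rw [← Finset.mul_sum, he, mul_zero]
      have h3 : eval (v' x) p = 0 := by rw [hv' hp, hvp, mul_zero]
      have h4 : eval (v' x) (lineForm t - 1) = 0 := by
        rw [map_sub, hv' (k := 1) (lineForm_mem_forms t), map_one, pow_one,
          inv_mul_cancel₀ (hs x), sub_self]
      simp only [Pi.add_apply, Pi.smul_apply, smul_eq_mul, map_add, map_mul, h3, h4, zero_mul,
        add_zero, add_mul, Finset.sum_add_distrib, h1, h2]
  ext x i
  have := congrFun (congrFun key x) i
  simp only [e', Pi.smul_apply, smul_eq_mul, Pi.zero_apply] at this ⊢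
  exact (mul_eq_zero.1 this).resolve_left (pow_ne_zero _ (hs x))

end Evaluation

/-! ### The pairing of the blown up space with tuples of forms -/

/-- Multi-indices of weight `N` as finitely supported functions. -/
def blockIndexEquiv (N : ℕ) : BlockIndex (N + 1) ≃
    ((Finset.univ : Finset (Fin 3)).finsuppAntidiag N : Finset (Fin 3 →₀ ℕ)) where
  toFun β := ⟨Finsupp.equivFunOnFinite.symm β.1, by
    rw [Finset.mem_finsuppAntidiag]
    refine ⟨?_, Finset.subset_univ _⟩
    have := β.2
    simp only [Fin.sum_univ_three, Finsupp.equivFunOnFinite_symm_apply_apply]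
    omega⟩
  invFun u := ⟨u.1, by
    have := (Finset.mem_finsuppAntidiag.1 u.2).1
    simp only [Fin.sum_univ_three] at this
    omega⟩
  left_inv β := by ext; rfl
  right_inv u := by ext; rfl

instance (N : ℕ) : Fintype (BlockIndex (N + 1)) := Fintype.ofEquiv _ (blockIndexEquiv N).symm

/-- The exponent belonging to a multi-index. -/
def blockExp {N : ℕ} (β : BlockIndex (N + 1)) : Fin 3 →₀ ℕ := (blockIndexEquiv N β).1

lemma blockExp_apply {N : ℕ} (β : BlockIndex (N + 1)) (k : Fin 3) : blockExp β k = β.1 k := rfl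

lemma degree_blockExp {N : ℕ} (β : BlockIndex (N + 1)) : (blockExp β).degree = N := by
  rw [Finsupp.degree_eq_sum]
  exact (Finset.mem_finsuppAntidiag.1 (blockIndexEquiv N β).2).1

lemma blockExp_injective {N : ℕ} : Function.Injective (blockExp (N := N)) :=
  Subtype.val_injective.comp (blockIndexEquiv N).injective

lemma exists_blockExp_eq {N : ℕ} {u : Fin 3 →₀ ℕ} (hu : u.degree = N) :
    ∃ β : BlockIndex (N + 1), blockExp β = u := by
  refine ⟨(blockIndexEquiv N).symm ⟨u, Finset.mem_finsuppAntidiag.2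
    ⟨by rw [← hu, Finsupp.degree_eq_sum], Finset.subset_univ _⟩⟩, ?_⟩
  rw [blockExp, Equiv.apply_symm_apply]

lemma eval_eq_sum_blockIndex {N : ℕ} {f : MvPolynomial (Fin 3) ℂ} (hf : f ∈ forms N)
    (v : Fin 3 → ℂ) : eval v f = ∑ β : BlockIndex (N + 1),
      coeff (blockExp β) f * (v 0 ^ β.1 0 * v 1 ^ β.1 1 * v 2 ^ β.1 2) := by
  have h1 : ∀ β : BlockIndex (N + 1), coeff (blockExp β) f
      * (v 0 ^ β.1 0 * v 1 ^ β.1 1 * v 2 ^ β.1 2)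
      = coeff (blockExp β) f * ∏ k, v k ^ blockExp β k := fun β => by
    rw [Fin.prod_univ_three]
    rfl
  simp_rw [h1]
  rw [eval_eq', ← Finset.sum_image (f := fun u => coeff u f * ∏ k, v k ^ u k)
    (g := blockExp) (s := Finset.univ) (fun _ _ _ _ h => blockExp_injective h)]
  refine Finset.sum_subset (fun u hu => ?_) (fun u _ hu => ?_)
  · have := mem_forms.1 hf u (mem_support_iff.1 hu)
    obtain ⟨β, hβ⟩ := exists_blockExp_eq (N := N) (u := u) (by exact_mod_cast this)
    exact Finset.mem_image.2 ⟨β, Finset.mem_univ _, hβ⟩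
  · rw [notMem_support_iff.1 hu, zero_mul]

/-- The pairing of `W_n` with tuples of polynomials, through the coefficients of degree
`n - 1`. -/
def blockPairing (m N : ℕ) : BlownUpSpace m (N + 1) →ₗ[ℂ]
    Module.Dual ℂ (Fin m → MvPolynomial (Fin 3) ℂ) :=
  LinearMap.mk₂ ℂ (fun w f => ∑ β, ∑ i, coeff (blockExp β) (f i) * w β i)
    (fun w w' f => by simp [mul_add, Finset.sum_add_distrib])
    (fun c w f => by simp [Finset.mul_sum, mul_left_comm])
    (fun w f f' => by simp [add_mul, Finset.sum_add_distrib])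
    (fun c w f => by simp [Finset.mul_sum, mul_assoc])

lemma blockPairing_apply {m N : ℕ} (w : BlownUpSpace m (N + 1))
    (f : Fin m → MvPolynomial (Fin 3) ℂ) :
    blockPairing m N w f = ∑ β, ∑ i, coeff (blockExp β) (f i) * w β i := rfl

/-- This is the purpose of the pairing: the powers in the Vandermonde vector are the values of the
monomials at `v`, so linear relations between such vectors become relations between evaluations. -/
lemma blockPairing_vandermondeVec {m N : ℕ} (v : Fin 3 → ℂ) (e : Fin m → ℂ)
    {f : Fin m → MvPolynomial (Fin 3) ℂ} (hf : f ∈ formTuples (Fin m) N) :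
    blockPairing m N (vandermondeVec (N + 1) v e) f = ∑ i, eval v (f i) * e i := by
  rw [blockPairing_apply, Finset.sum_comm]
  refine Finset.sum_congr rfl fun i _ => ?_
  rw [eval_eq_sum_blockIndex (mem_formTuples.1 hf i), Finset.sum_mul]
  refine Finset.sum_congr rfl fun β _ => ?_
  simp [vandermondeVec, mul_assoc]

lemma blockPairing_single {m N : ℕ} (w : BlownUpSpace m (N + 1)) (β : BlockIndex (N + 1))
    (i : Fin m) (c : ℂ) :
    blockPairing m N w (Pi.single i (monomial (blockExp β) c)) = c * w β i := by
  rw [blockPairing_apply, Finset.sum_eq_single β, Finset.sum_eq_single i]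
  · simp
  · intro j _ hj
    simp [hj]
  · simp
  · intro β' _ hβ
    refine Finset.sum_eq_zero fun j _ => ?_
    by_cases hj : j = i
    · subst hj
      rw [Pi.single_eq_same, coeff_monomial, if_neg fun h => hβ (blockExp_injective h).symm,
        zero_mul]
    · simp [hj]
  · simp

lemma monomial_blockExp_mem_forms {N : ℕ} (β : BlockIndex (N + 1)) (c : ℂ) :
    monomial (blockExp β) c ∈ forms N := by
  refine mem_forms.2 fun u hu => ?_
  rw [coeff_monomial] at hu
  split_ifs at hu with h
  · rw [← h, degree_blockExp]
  · exact absurd rfl hu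

lemma single_mem_formTuples {ι : Type*} [DecidableEq ι] {d : ℤ} {f : MvPolynomial (Fin 3) ℂ}
    (hf : f ∈ forms d) (i : ι) :
    (Pi.single i f : ι → MvPolynomial (Fin 3) ℂ) ∈ formTuples ι d := by
  refine mem_formTuples.2 fun j => ?_
  by_cases h : j = i
  · subst h; rwa [Pi.single_eq_same]
  · rw [Pi.single_eq_of_ne h]; exact zero_mem _

end

noncomputable section

/-! ### The principal subspace as an annihilator -/

variable {m : ℕ} (D : Fin 3 → Matrix (Fin m) (Fin m) ℂ)

/-- The matrix of linear forms `x₀ D₀ + x₁ D₁ - x₂ D₂`. -/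
def pencilPoly : Matrix (Fin m) (Fin m) (MvPolynomial (Fin 3) ℂ) :=
  (X 0 : MvPolynomial (Fin 3) ℂ) • (D 0).map C + (X 1 : MvPolynomial (Fin 3) ℂ) • (D 1).map C
    - (X 2 : MvPolynomial (Fin 3) ℂ) • (D 2).map C

lemma det_pencilPoly : (pencilPoly D).det = detPoly D := rfl

lemma pencilPoly_apply (i j : Fin m) :
    pencilPoly D i j = X 0 * C (D 0 i j) + X 1 * C (D 1 i j) - X 2 * C (D 2 i j) := rfl

lemma pencilPoly_mem_forms (i j : Fin m) : pencilPoly D i j ∈ forms 1 := by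
  have h (k : Fin 3) (c : ℂ) : X k * C c ∈ forms 1 := by
    rw [mul_comm, C_mul']
    exact Submodule.smul_mem _ _ (mem_forms_iff_isHomogeneous.2 (isHomogeneous_X ℂ k))
  exact sub_mem (add_mem (h 0 _) (h 1 _)) (h 2 _)

lemma eval_pencilPoly (v : Fin 3 → ℂ) (i j : Fin m) :
    eval v (pencilPoly D i j) = pencil D v i j := by
  simp [pencilPoly_apply, pencil]

lemma detPoly_mem_forms : detPoly D ∈ forms m := by
  rw [← det_pencilPoly, Matrix.det_apply]
  refine sum_mem fun σ _ => ?_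
  have h : ∏ i, pencilPoly D (σ i) i ∈ forms m := by
    have := IsWeightedHomogeneous.prod Finset.univ (fun i => pencilPoly D (σ i) i)
      (fun _ => (1 : ℤ)) (fun i _ => pencilPoly_mem_forms D _ _)
    simp only [Finset.sum_const, Finset.card_univ, Fintype.card_fin, nsmul_eq_mul, mul_one] at this
    exact this
  rw [Units.smul_def, zsmul_eq_mul, ← zsmul_eq_mul]
  exact zsmul_mem h _

lemma blockExp_raise {N : ℕ} (u : Fin 3 → ℕ) (hu : u 0 + u 1 + u 2 + 2 = N + 1) (k : Fin 3) :
    blockExp (raise u hu k) = Finsupp.equivFunOnFinite.symm u + Finsupp.single k 1 := by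
  ext i
  rw [blockExp_apply]
  simp [raise, Finsupp.single_apply, Pi.single_apply, eq_comm]

/-- Multiplying a monomial by a variable shifts its exponent to one of the three raised indices, and
moving the `D k` from the vector to the tuple transposes them. So each scalar equation defining
`V_n` is a pairing with a column of the transposed pencil times a monomial. -/
lemma blockPairing_transpose_mulVec {N : ℕ} (w : BlownUpSpace m (N + 1)) (u : Fin 3 → ℕ)
    (hu : u 0 + u 1 + u 2 + 2 = N + 1) (r : Fin m) (c : ℂ) :
    blockPairing m N w ((pencilPoly D).transpose.mulVec
        (Pi.single r (monomial (Finsupp.equivFunOnFinite.symm u) c)))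
      = c * ((D 0).mulVec (w (raise u hu 0)) + (D 1).mulVec (w (raise u hu 1))
        - (D 2).mulVec (w (raise u hu 2))) r := by
  have h1 : (pencilPoly D).transpose.mulVec
        (Pi.single r (monomial (Finsupp.equivFunOnFinite.symm u) c))
      = ∑ i : Fin m, ((Pi.single i (monomial (blockExp (raise u hu 0)) (c * D 0 r i)) :
          Fin m → MvPolynomial (Fin 3) ℂ)
        + Pi.single i (monomial (blockExp (raise u hu 1)) (c * D 1 r i))
        - Pi.single i (monomial (blockExp (raise u hu 2)) (c * D 2 r i))) := by
    conv_lhs => rw [← Finset.univ_sum_single ((pencilPoly D).transpose.mulVec _)]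
    refine Finset.sum_congr rfl fun i _ => ?_
    rw [← Pi.single_add, ← Pi.single_sub]
    congr 1
    rw [Matrix.mulVec_single]
    simp only [blockExp_raise, Pi.smul_apply, Matrix.col_apply,
      Matrix.transpose_apply, pencilPoly_apply, MulOpposite.smul_eq_mul_unop,
      MulOpposite.unop_op]
    have hX (k : Fin 3) (b : ℂ) : monomial (Finsupp.equivFunOnFinite.symm u
        + Finsupp.single k 1) (c * b)
        = monomial (Finsupp.equivFunOnFinite.symm u) c * (X k * C b) := by
      rw [X, C_apply, monomial_mul, monomial_mul, one_mul, add_zero]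
    rw [hX, hX, hX]
    ring
  rw [h1, map_sum]
  simp only [map_add, map_sub, blockPairing_single, Matrix.mulVec, dotProduct, Pi.add_apply,
    Pi.sub_apply, Finset.sum_add_distrib, Finset.sum_sub_distrib, Finset.mul_sum, mul_add,
    mul_sub, mul_assoc]

/-- Tuples with a single monomial entry of degree `n - 2` span and correspond to the defining
equations. For `N = 0` there are no equations and no nonzero forms of degree `-1`. -/
lemma mem_principalSubspace_iff {N : ℕ} {w : BlownUpSpace m (N + 1)} :
    w ∈ principalSubspace D (N + 1) ↔ ∀ g ∈ formTuples (Fin m) ((N : ℤ) - 1),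
      blockPairing m N w ((pencilPoly D).transpose.mulVec g) = 0 := by
  constructor
  · intro hw g hg
    have hsingle : ∀ r, ∀ f ∈ forms ((N : ℤ) - 1), blockPairing m N w
        ((pencilPoly D).transpose.mulVec (Pi.single r f)) = 0 := by
      intro r f hf
      rw [f.as_sum]
      have : (Pi.single r (∑ u ∈ f.support, monomial u (coeff u f)) :
          Fin m → MvPolynomial (Fin 3) ℂ)
          = ∑ u ∈ f.support, Pi.single r (monomial u (coeff u f)) :=
        map_sum (AddMonoidHom.single (fun _ : Fin m => MvPolynomial (Fin 3) ℂ) r) _ _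
      rw [this, Matrix.mulVec_sum, map_sum]
      refine Finset.sum_eq_zero fun u hu => ?_
      have hd := mem_forms.1 hf u (mem_support_iff.1 hu)
      rw [Finsupp.degree_eq_sum, Fin.sum_univ_three] at hd
      have h1 : u 0 + u 1 + u 2 + 2 = N + 1 := by push_cast at hd; omega
      have h2 := blockPairing_transpose_mulVec D w u h1 r (coeff u f)
      rw [Finsupp.equivFunOnFinite_symm_coe] at h2
      rw [h2, hw u h1, Pi.zero_apply, mul_zero]
    rw [← Finset.univ_sum_single g, Matrix.mulVec_sum, map_sum]
    exact Finset.sum_eq_zero fun r _ => hsingle r _ (mem_formTuples.1 hg r)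
  · intro h u hu
    ext1 r
    have h1 := h (Pi.single r (monomial (Finsupp.equivFunOnFinite.symm u) 1))
      (single_mem_formTuples (mem_forms.2 fun x hx => by
        rw [coeff_monomial] at hx
        split_ifs at hx with hux
        · rw [← hux, Finsupp.degree_eq_sum, Fin.sum_univ_three]
          simp only [Finsupp.equivFunOnFinite_symm_apply_apply]
          omega
        · exact absurd rfl hx) r)
    rw [blockPairing_transpose_mulVec D w u hu, one_mul] at h1
    exact h1

/-- The pairing identifies `W_n` with the dual of the tuples of forms of degree `n - 1`. -/
def blownUpEquiv (m N : ℕ) : BlownUpSpace m (N + 1) ≃ₗ[ℂ]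
    Module.Dual ℂ (formTuples (Fin m) N) :=
  LinearEquiv.ofInjectiveOfFinrankEq
    ((Submodule.dualRestrict (formTuples (Fin m) N)).comp (blockPairing m N))
    (by
      rw [injective_iff_map_eq_zero]
      intro w hw
      ext β i
      have h1 := DFunLike.congr_fun hw ⟨_, single_mem_formTuples (monomial_blockExp_mem_forms β 1) i⟩
      have h2 := blockPairing_single w β i 1
      rw [one_mul] at h2
      rw [Pi.zero_apply, Pi.zero_apply, ← h2]
      exact h1)
    (by
      have h1 : Module.finrank ℂ (formTuples (Fin m) N)
          = m * ((Finset.univ : Finset (Fin 3)).finsuppAntidiag N).card := by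
        rw [(formTuplesEquiv (Fin m) N).finrank_eq, Module.finrank_pi_fintype]
        simp only [(formsEquiv N).finrank_eq, Module.finrank_fintype_fun_eq_card, Finset.sum_const,
          smul_eq_mul, Finset.card_univ, Fintype.card_fin, Fintype.card_coe]
      rw [Subspace.dual_finrank_eq, h1, Module.finrank_pi_fintype]
      simp only [Module.finrank_fintype_fun_eq_card, Finset.sum_const, smul_eq_mul,
        Finset.card_univ, Fintype.card_fin]
      rw [mul_comm, Fintype.card_congr (blockIndexEquiv N), Fintype.card_coe])

/-- The annihilated subspace is the image, under an injective map, of the tuples one degree lower.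
So the dimension is the difference of two consecutive values for tuples of forms. -/
lemma finrank_principalSubspace {N : ℕ} (h0 : detPoly D ≠ 0) :
    Module.finrank ℂ (principalSubspace D (N + 1)) = m * (N + 1) := by
  let G : Submodule ℂ (formTuples (Fin m) N) :=
    ((formTuples (Fin m) ((N : ℤ) - 1)).map (matrixMap (pencilPoly D).transpose)).comap
      (formTuples (Fin m) N).subtype
  have hmem : ∀ g ∈ formTuples (Fin m) ((N : ℤ) - 1),
      (pencilPoly D).transpose.mulVec g ∈ formTuples (Fin m) N := fun g hg => by
    have := mulVec_mem_formTuples (A := (pencilPoly D).transpose)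
      (fun i j => pencilPoly_mem_forms D j i) hg
    rwa [add_sub_cancel] at this
  have hG : principalSubspace D (N + 1)
      = G.dualAnnihilator.comap (blownUpEquiv m N).toLinearMap := by
    ext w
    rw [mem_principalSubspace_iff, Submodule.mem_comap, Submodule.mem_dualAnnihilator]
    constructor
    · rintro h ⟨_, hf⟩ ⟨g, hg, rfl⟩
      exact h g hg
    · intro h g hg
      exact h ⟨_, hmem g hg⟩ ⟨g, hg, rfl⟩
  have h1 : Module.finrank ℂ (principalSubspace D (N + 1))
      = Module.finrank ℂ G.dualAnnihilator := by
    rw [hG, Submodule.comap_equiv_eq_map_symm]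
    exact LinearEquiv.finrank_map_eq _ _
  have h2 := Subspace.finrank_add_finrank_dualAnnihilator_eq G
  have h3 : Module.finrank ℂ G = Module.finrank ℂ (formTuples (Fin m) ((N : ℤ) - 1)) := by
    rw [(Submodule.comapSubtypeEquivOfLe _).finrank_eq, finrank_map_of_injective]
    · exact matrixMap_injective (by rwa [Matrix.det_transpose])
    · rintro _ ⟨g, hg, rfl⟩
      exact hmem g hg
  have h4 := finrank_formTuples (Fin m) (d := N) (by omega)
  have h5 := finrank_formTuples (Fin m) (d := (N : ℤ) - 1) (by omega)
  rw [Fintype.card_fin] at h4 h5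
  rw [h1]
  zify at h2 h3 ⊢
  linarith

end

noncomputable section

/-! ### Local rings and the change of charts -/

lemma isUnit_algebraMap_localRingAt {v : Fin 3 → ℂ} {f : MvPolynomial (Fin 3) ℂ}
    (hf : eval v f ≠ 0) : IsUnit (algebraMap _ (LocalRingAt v) f) :=
  IsLocalization.map_units (LocalRingAt v)
    (⟨f, hf⟩ : (RingHom.ker (eval v)).primeCompl)

/-- Evaluation at `v` on the local ring at `v`. -/
def localEval (v : Fin 3 → ℂ) : LocalRingAt v →ₐ[ℂ] ℂ :=
  IsLocalization.liftAlgHom (M := (RingHom.ker (eval v)).primeCompl) (f := aeval v)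
    fun s => isUnit_iff_ne_zero.2 s.2

@[simp] lemma localEval_algebraMap (v : Fin 3 → ℂ) (f : MvPolynomial (Fin 3) ℂ) :
    localEval v (algebraMap _ _ f) = eval v f := by
  simp [localEval, IsLocalization.liftAlgHom_apply]

lemma isUnit_of_localEval_ne_zero {v : Fin 3 → ℂ} {y : LocalRingAt v}
    (hy : localEval v y ≠ 0) : IsUnit y := by
  obtain ⟨⟨f, s⟩, hfs⟩ := IsLocalization.surj (RingHom.ker (eval v)).primeCompl y
  dsimp only at hfs
  have h1 := congrArg (localEval v) hfs
  rw [map_mul, localEval_algebraMap, localEval_algebraMap] at h1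
  have h2 : eval v f ≠ 0 := h1 ▸ mul_ne_zero hy s.2
  exact isUnit_of_mul_isUnit_left (hfs ▸ isUnit_algebraMap_localRingAt h2)

/-- The local ring at `v` modulo `q`, `p` and the equation of the affine plane through `v` defined
by the linear form `l`. -/
abbrev LocalQuot (q p l : MvPolynomial (Fin 3) ℂ) (v : Fin 3 → ℂ) : Type :=
  LocalRingAt v ⧸ Ideal.map (algebraMap (MvPolynomial (Fin 3) ℂ) (LocalRingAt v))
    (Ideal.span {q, p, l - C (eval v l)})

lemma localQuot_algebraMap_eq_zero {q p l f : MvPolynomial (Fin 3) ℂ} {v : Fin 3 → ℂ}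
    (hf : f ∈ Ideal.span {q, p, l - C (eval v l)}) :
    algebraMap (MvPolynomial (Fin 3) ℂ) (LocalQuot q p l v) f = 0 := by
  rw [IsScalarTower.algebraMap_apply _ (LocalRingAt v)]
  exact Ideal.Quotient.eq_zero_iff_mem.2 (Ideal.mem_map_of_mem _ hf)

lemma localQuot_algHom_ext {q p l : MvPolynomial (Fin 3) ℂ} {v : Fin 3 → ℂ} {S : Type*}
    [CommRing S] [Algebra ℂ S] {φ ψ : LocalQuot q p l v →ₐ[ℂ] S}
    (h : ∀ i, φ (algebraMap (MvPolynomial (Fin 3) ℂ) _ (X i))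
      = ψ (algebraMap (MvPolynomial (Fin 3) ℂ) _ (X i))) : φ = ψ := by
  have h1 : φ.comp (IsScalarTower.toAlgHom ℂ (MvPolynomial (Fin 3) ℂ) (LocalQuot q p l v))
      = ψ.comp (IsScalarTower.toAlgHom ℂ (MvPolynomial (Fin 3) ℂ) (LocalQuot q p l v)) :=
    MvPolynomial.algHom_ext h
  refine Ideal.Quotient.algHom_ext _ ?_
  exact IsLocalization.algHom_ext (W := (RingHom.ker (eval v)).primeCompl) h1

lemma localQuot_algHom_apply {q p l : MvPolynomial (Fin 3) ℂ} {v : Fin 3 → ℂ} {S : Type*}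
    [CommRing S] [Algebra ℂ S] (φ : LocalQuot q p l v →ₐ[ℂ] S) (f : MvPolynomial (Fin 3) ℂ) :
    φ (algebraMap (MvPolynomial (Fin 3) ℂ) _ f)
      = aeval (fun i => φ (algebraMap (MvPolynomial (Fin 3) ℂ) _ (X i))) f := by
  have h1 : φ.comp (IsScalarTower.toAlgHom ℂ (MvPolynomial (Fin 3) ℂ) (LocalQuot q p l v))
      = aeval (fun i => φ (algebraMap (MvPolynomial (Fin 3) ℂ) _ (X i))) := by
    ext i
    simp
  exact DFunLike.congr_fun h1 f

lemma aeval_algebraMap_X {S : Type*} [CommRing S] [Algebra ℂ S]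
    [Algebra (MvPolynomial (Fin 3) ℂ) S] [IsScalarTower ℂ (MvPolynomial (Fin 3) ℂ) S]
    (f : MvPolynomial (Fin 3) ℂ) :
    aeval (fun i => algebraMap (MvPolynomial (Fin 3) ℂ) S (X i)) f = algebraMap _ S f := by
  have : aeval (fun i => algebraMap (MvPolynomial (Fin 3) ℂ) S (X i))
      = IsScalarTower.toAlgHom ℂ (MvPolynomial (Fin 3) ℂ) S := by
    ext i
    simp
  exact DFunLike.congr_fun this f

section ChartChange

variable {q p l l' : MvPolynomial (Fin 3) ℂ} {a n : ℕ} {v v' : Fin 3 → ℂ} {c : ℂ}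

/-- Projection from the origin of one affine plane to another. -/
lemma exists_chartHom (hq : q ∈ forms a) (hp : p ∈ forms n) (hl' : l' ∈ forms 1)
    (hv : v' = c • v) (h' : eval v' l' ≠ 0) :
    ∃ (θ : LocalQuot q p l' v' →ₐ[ℂ] LocalQuot q p l v) (u : LocalQuot q p l v),
      (∀ i, θ (algebraMap (MvPolynomial (Fin 3) ℂ) _ (X i))
        = u * algebraMap (MvPolynomial (Fin 3) ℂ) _ (X i)) := by
  have e1 : eval v' l' = c * eval v l' := by
    have := eval_smul_of_mem_forms (n := 1) hl' c v
    rwa [pow_one, ← hv] at this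
  have h : eval v l' ≠ 0 := fun h0 => h' (by rw [e1, h0, mul_zero])
  obtain ⟨w, hw⟩ := (isUnit_algebraMap_localRingAt h).exists_right_inv
  -- The rational function `l'(v') / l'` is the factor that moves a point along its line through the
  -- origin to the plane `l' = l'(v')`.
  let u₀ : LocalRingAt v := algebraMap ℂ _ (eval v' l') * w
  have hu₀ : u₀ * algebraMap _ _ l' = algebraMap ℂ _ (eval v' l') := by
    rw [mul_assoc, mul_comm w, hw, mul_one]
  have hεu : localEval v u₀ = c := by
    have h2 := congrArg (localEval v) hu₀
    rw [map_mul, localEval_algebraMap, AlgHom.commutes, e1] at h2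
    exact mul_right_cancel₀ h h2
  let g : MvPolynomial (Fin 3) ℂ →ₐ[ℂ] LocalRingAt v :=
    aeval fun i => u₀ * algebraMap (MvPolynomial (Fin 3) ℂ) _ (X i)
  have hg : ∀ {k : ℕ} {f : MvPolynomial (Fin 3) ℂ}, f ∈ forms k →
      g f = u₀ ^ k * algebraMap _ _ f := fun hf => by
    have := aeval_smul_of_mem_forms hf u₀
      (fun i => algebraMap (MvPolynomial (Fin 3) ℂ) (LocalRingAt v) (X i))
    rwa [aeval_algebraMap_X] at this
  -- The projection sends `v` to `v'`, so polynomials that do not vanish at `v'` become units and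
  -- the map extends to the local ring.
  have hεg : ∀ f, localEval v (g f) = eval v' f := by
    have : (localEval v).comp g = aeval v' := by
      ext i
      simp [g, hεu, hv]
    exact DFunLike.congr_fun this
  let Θ : LocalRingAt v' →ₐ[ℂ] LocalRingAt v :=
    IsLocalization.liftAlgHom (M := (RingHom.ker (eval v')).primeCompl) (f := g)
      fun s => isUnit_of_localEval_ne_zero (by rw [hεg]; exact s.2)
  have hΘ : ∀ f, Θ (algebraMap _ _ f) = g f := fun f => by
    simp [Θ, IsLocalization.liftAlgHom_apply]
  let J := Ideal.map (algebraMap (MvPolynomial (Fin 3) ℂ) (LocalRingAt v))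
    (Ideal.span {q, p, l - C (eval v l)})
  have hJ : Ideal.map (algebraMap (MvPolynomial (Fin 3) ℂ) (LocalRingAt v'))
      (Ideal.span {q, p, l' - C (eval v' l')}) ≤ J.comap Θ := by
    rw [Ideal.map_le_iff_le_comap, Ideal.span_le]
    rintro f (rfl | rfl | rfl)
    · change Θ (algebraMap _ _ _) ∈ J
      rw [hΘ, hg hq]
      exact Ideal.mul_mem_left _ _ (Ideal.mem_map_of_mem _ (Ideal.subset_span (by simp)))
    · change Θ (algebraMap _ _ _) ∈ J
      rw [hΘ, hg hp]
      exact Ideal.mul_mem_left _ _ (Ideal.mem_map_of_mem _ (Ideal.subset_span (by simp)))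
    · change Θ (algebraMap _ _ _) ∈ J
      rw [hΘ, map_sub, hg (k := 1) hl', pow_one, hu₀, ← algebraMap_eq, AlgHom.commutes, sub_self]
      exact zero_mem _
  refine ⟨Ideal.quotientMapₐ J Θ hJ, Ideal.Quotient.mk _ u₀, fun i => ?_⟩
  change Ideal.Quotient.mk J (Θ (algebraMap _ _ (X i))) = _
  rw [hΘ, aeval_X, map_mul]
  rfl

/-- The composite multiplies every coordinate by `θ u' * u`. This factor is `1`, as one sees by
applying the composite to `l`, which is a nonzero constant on its own plane. -/
lemma chartHom_comp_eq_id (hl : l ∈ forms 1) (h : eval v l ≠ 0)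
    (θ : LocalQuot q p l' v' →ₐ[ℂ] LocalQuot q p l v) (u : LocalQuot q p l v)
    (hθ : ∀ i, θ (algebraMap (MvPolynomial (Fin 3) ℂ) _ (X i))
        = u * algebraMap (MvPolynomial (Fin 3) ℂ) _ (X i))
    (θ' : LocalQuot q p l v →ₐ[ℂ] LocalQuot q p l' v') (u' : LocalQuot q p l' v')
    (hθ' : ∀ i, θ' (algebraMap (MvPolynomial (Fin 3) ℂ) _ (X i))
        = u' * algebraMap (MvPolynomial (Fin 3) ℂ) _ (X i)) :
    θ.comp θ' = AlgHom.id ℂ _ := by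
  have hlv : ∀ (w : Fin 3 → ℂ) (m : MvPolynomial (Fin 3) ℂ),
      algebraMap (MvPolynomial (Fin 3) ℂ) (LocalQuot q p m w) m
        = algebraMap ℂ _ (eval w m) := by
    intro w m
    have := localQuot_algebraMap_eq_zero (q := q) (p := p) (l := m) (v := w)
      (f := m - C (eval w m)) (Ideal.subset_span (by simp))
    rw [map_sub, sub_eq_zero] at this
    exact this.trans (IsScalarTower.algebraMap_apply ℂ (MvPolynomial (Fin 3) ℂ) _ _).symm
  have e1 : θ (algebraMap (MvPolynomial (Fin 3) ℂ) _ l)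
      = u * algebraMap ℂ _ (eval v l) := by
    refine (localQuot_algHom_apply (S := LocalQuot q p l v) θ l).trans ?_
    simp only [hθ]
    refine (aeval_smul_of_mem_forms (S := LocalQuot q p l v) (n := 1) hl u _).trans ?_
    rw [aeval_algebraMap_X (S := LocalQuot q p l v), pow_one, hlv]
  have e2 : θ' (algebraMap (MvPolynomial (Fin 3) ℂ) _ l)
      = u' * algebraMap (MvPolynomial (Fin 3) ℂ) _ l := by
    refine (localQuot_algHom_apply (S := LocalQuot q p l' v') θ' l).trans ?_
    simp only [hθ']
    refine (aeval_smul_of_mem_forms (S := LocalQuot q p l' v') (n := 1) hl u' _).trans ?_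
    rw [aeval_algebraMap_X (S := LocalQuot q p l' v'), pow_one]
  have e3 : θ u' * u = 1 := by
    have h1 := congrArg θ e2
    rw [hlv, AlgHom.commutes, AlgHom.commutes, map_mul, e1, ← mul_assoc] at h1
    have h2 : IsUnit (algebraMap ℂ (LocalQuot q p l v) (eval v l)) :=
      (isUnit_iff_ne_zero.2 h).map _
    exact (h2.mul_right_cancel (by rw [one_mul]; exact h1)).symm
  refine localQuot_algHom_ext (S := LocalQuot q p l v) fun i => ?_
  rw [AlgHom.comp_apply, hθ', map_mul, hθ, ← mul_assoc, e3, one_mul, AlgHom.id_apply]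

/-- The intersection multiplicity depends neither on the representative of the point nor on the
chart, so the charts adapted to single points can be traded for one common chart. -/
lemma nonempty_localQuot_algEquiv (hq : q ∈ forms a) (hp : p ∈ forms n) (hl : l ∈ forms 1)
    (hl' : l' ∈ forms 1) (hv : v' = c • v) (h : eval v l ≠ 0) (h' : eval v' l' ≠ 0) :
    Nonempty (LocalQuot q p l' v' ≃ₐ[ℂ] LocalQuot q p l v) := by
  have hc : c ≠ 0 := by
    rintro rfl
    have := eval_smul_of_mem_forms (n := 1) hl' 0 v
    rw [← hv, pow_one, zero_mul] at this
    exact h' this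
  obtain ⟨θ, u, hθ⟩ := exists_chartHom (l := l) hq hp hl' hv h'
  obtain ⟨θ', u', hθ'⟩ := exists_chartHom (l := l') (v := v') (c := c⁻¹) hq hp hl
    (by rw [hv, inv_smul_smul₀ hc]) h
  exact ⟨AlgEquiv.ofAlgHom θ θ' (chartHom_comp_eq_id hl h θ u hθ θ' u' hθ')
    (chartHom_comp_eq_id hl' h' θ' u' hθ' θ u hθ)⟩

end ChartChange

lemma chartForm_mem_forms (v : Fin 3 → ℂ) : chartForm v ∈ forms 1 :=
  sum_mem fun k _ => by
    rw [C_mul']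
    exact Submodule.smul_mem _ _ (mem_forms_iff_isHomogeneous.2 (isHomogeneous_X ℂ k))

lemma eval_chartForm_ne_zero {v : Fin 3 → ℂ} (hv : v ≠ 0) : eval v (chartForm v) ≠ 0 := by
  have h1 : eval v (chartForm v) = ((∑ k, Complex.normSq (v k) : ℝ) : ℂ) := by
    simp [chartForm, Complex.normSq_eq_conj_mul_self]
  rw [h1]
  obtain ⟨k, hk⟩ := Function.ne_iff.1 hv
  have : 0 < ∑ k, Complex.normSq (v k) :=
    Finset.sum_pos' (fun i _ => Complex.normSq_nonneg _)
      ⟨k, Finset.mem_univ _, Complex.normSq_pos.2 hk⟩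
  exact_mod_cast this.ne'

lemma intersectionMult_eq (q p : MvPolynomial (Fin 3) ℂ) (v : Fin 3 → ℂ) :
    intersectionMult q p v = Module.finrank ℂ (LocalQuot q p (chartForm v) v) := rfl

end

noncomputable section

/-! ### Decomposition of a zero dimensional ring into its local rings -/

section LocalGlobal

variable (J : Ideal (MvPolynomial (Fin 3) ℂ))

/-- The maximal ideal of `R / J` at a zero `v` of `J`. -/
def pointIdeal {v : Fin 3 → ℂ} (hv : ∀ f ∈ J, eval v f = 0) :
    MaximalSpectrum (MvPolynomial (Fin 3) ℂ ⧸ J) :=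
  ⟨RingHom.ker (Ideal.Quotient.lift J (eval v) hv),
    RingHom.ker_isMaximal_of_surjective _ fun c => ⟨Ideal.Quotient.mk J (C c), by simp⟩⟩

lemma mk_mem_pointIdeal {v : Fin 3 → ℂ} (hv : ∀ f ∈ J, eval v f = 0)
    (f : MvPolynomial (Fin 3) ℂ) :
    Ideal.Quotient.mk J f ∈ (pointIdeal J hv).asIdeal ↔ eval v f = 0 := by
  rw [pointIdeal, RingHom.mem_ker, Ideal.Quotient.lift_mk]

/-- The Nullstellensatz, applied to the preimage of the maximal ideal in the polynomial ring. -/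
lemma exists_eq_pointIdeal (I : MaximalSpectrum (MvPolynomial (Fin 3) ℂ ⧸ J)) :
    ∃ (v : Fin 3 → ℂ) (hv : ∀ f ∈ J, eval v f = 0), I = pointIdeal J hv := by
  have := I.isMaximal
  have hmax : (I.asIdeal.comap (Ideal.Quotient.mk J)).IsMaximal :=
    Ideal.comap_isMaximal_of_surjective _ Ideal.Quotient.mk_surjective
  obtain ⟨v, hv⟩ := isMaximal_iff_eq_vanishingIdeal_singleton.1 hmax
  have hmem : ∀ f, Ideal.Quotient.mk J f ∈ I.asIdeal ↔ eval v f = 0 := fun f => by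
    rw [← Ideal.mem_comap, hv, mem_vanishingIdeal_singleton_iff]
    rfl
  have hJ : ∀ f ∈ J, eval v f = 0 := fun f hf => by
    rw [← hmem, Ideal.Quotient.eq_zero_iff_mem.2 hf]
    exact zero_mem _
  refine ⟨v, hJ, MaximalSpectrum.ext (Ideal.ext fun y => ?_)⟩
  obtain ⟨f, rfl⟩ := Ideal.Quotient.mk_surjective y
  rw [hmem, mk_mem_pointIdeal]

instance isScalarTower_localQuotient (v : Fin 3 → ℂ) :
    IsScalarTower ℂ (MvPolynomial (Fin 3) ℂ ⧸ J)
      (LocalRingAt v ⧸ Ideal.map (algebraMap (MvPolynomial (Fin 3) ℂ) (LocalRingAt v)) J) :=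
  IsScalarTower.of_algebraMap_eq (R := ℂ) (S := MvPolynomial (Fin 3) ℂ ⧸ J)
    (A := LocalRingAt v ⧸ Ideal.map (algebraMap (MvPolynomial (Fin 3) ℂ) (LocalRingAt v)) J)
    fun c =>
    congrArg (Ideal.Quotient.mk (Ideal.map (algebraMap (MvPolynomial (Fin 3) ℂ) (LocalRingAt v)) J))
      (IsScalarTower.algebraMap_apply ℂ (MvPolynomial (Fin 3) ℂ) (LocalRingAt v) c)

/-- The local ring of `R / J` at a zero of `J`. -/
def localizationPointIdealEquiv {v : Fin 3 → ℂ} (hv : ∀ f ∈ J, eval v f = 0) :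
    Localization.AtPrime (pointIdeal J hv).asIdeal ≃ₐ[MvPolynomial (Fin 3) ℂ ⧸ J]
      (LocalRingAt v ⧸ Ideal.map (algebraMap (MvPolynomial (Fin 3) ℂ) (LocalRingAt v)) J) :=
  have h1 : Algebra.algebraMapSubmonoid (MvPolynomial (Fin 3) ℂ ⧸ J)
      (RingHom.ker (eval v)).primeCompl = (pointIdeal J hv).asIdeal.primeCompl := by
    ext y
    obtain ⟨f, rfl⟩ := Ideal.Quotient.mk_surjective y
    rw [Ideal.mem_primeCompl_iff, mk_mem_pointIdeal]
    constructor
    · rintro ⟨g, hg, hgf⟩ h0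
      apply hg
      have := (mk_mem_pointIdeal J hv g).1 (by
        rw [show Ideal.Quotient.mk J g = Ideal.Quotient.mk J f from hgf, mk_mem_pointIdeal]
        exact h0)
      exact this
    · intro h
      exact ⟨f, h, rfl⟩
  have : IsLocalization (pointIdeal J hv).asIdeal.primeCompl
      (LocalRingAt v ⧸ Ideal.map (algebraMap (MvPolynomial (Fin 3) ℂ) (LocalRingAt v)) J) :=
    h1 ▸ inferInstance
  IsLocalization.algEquiv (pointIdeal J hv).asIdeal.primeCompl
    (Localization.AtPrime (pointIdeal J hv).asIdeal)
    (LocalRingAt v ⧸ Ideal.map (algebraMap (MvPolynomial (Fin 3) ℂ) (LocalRingAt v)) J)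

variable [FiniteDimensional ℂ (MvPolynomial (Fin 3) ℂ ⧸ J)]

lemma finite_localization_maximalSpectrum (I : MaximalSpectrum (MvPolynomial (Fin 3) ℂ ⧸ J)) :
    FiniteDimensional ℂ (Localization.AtPrime I.asIdeal) := by
  have : IsArtinianRing (MvPolynomial (Fin 3) ℂ ⧸ J) := IsArtinianRing.of_finite ℂ _
  exact Module.Finite.of_surjective
    (IsScalarTower.toAlgHom ℂ (MvPolynomial (Fin 3) ℂ ⧸ J)
      (Localization.AtPrime I.asIdeal)).toLinearMap
    (IsArtinianRing.localization_surjective I.asIdeal.primeCompl _)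

lemma finite_localQuotient {v : Fin 3 → ℂ} (hv : ∀ f ∈ J, eval v f = 0) :
    FiniteDimensional ℂ
      (LocalRingAt v ⧸ Ideal.map (algebraMap (MvPolynomial (Fin 3) ℂ) (LocalRingAt v)) J) := by
  have := finite_localization_maximalSpectrum J (pointIdeal J hv)
  exact Module.Finite.equiv
    ((localizationPointIdealEquiv J hv).toLinearEquiv.restrictScalars ℂ)

/-- The dimension of a zero dimensional ring is the sum of the dimensions of its local rings. -/
lemma sum_finrank_localQuotient {κ : Type*} [Fintype κ] (v : κ → Fin 3 → ℂ)
    (hinj : Function.Injective v) (hv : ∀ x, ∀ f ∈ J, eval (v x) f = 0)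
    (hall : ∀ w, (∀ f ∈ J, eval w f = 0) → ∃ x, v x = w) :
    ∑ x, Module.finrank ℂ (LocalRingAt (v x) ⧸
        Ideal.map (algebraMap (MvPolynomial (Fin 3) ℂ) (LocalRingAt (v x))) J)
      = Module.finrank ℂ (MvPolynomial (Fin 3) ℂ ⧸ J) := by
  have : IsArtinianRing (MvPolynomial (Fin 3) ℂ ⧸ J) := IsArtinianRing.of_finite ℂ _
  -- Maximal ideals are zeros of `J`; distinct zeros are told apart by the coordinate functions.
  let Φ : κ ≃ MaximalSpectrum (MvPolynomial (Fin 3) ℂ ⧸ J) :=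
    Equiv.ofBijective (fun x => pointIdeal J (hv x)) ⟨fun x y hxy => hinj <| by
      ext i
      have h1 := (mk_mem_pointIdeal J (hv x) (X i - C (v x i))).2 (by simp)
      have hxy' : pointIdeal J (hv x) = pointIdeal J (hv y) := hxy
      rw [hxy', mk_mem_pointIdeal] at h1
      simp only [map_sub, eval_X, eval_C, sub_eq_zero] at h1
      exact h1.symm, fun I => by
      obtain ⟨w, hw, rfl⟩ := exists_eq_pointIdeal J I
      obtain ⟨x, rfl⟩ := hall w hw
      exact ⟨x, rfl⟩⟩
  have : Fintype (MaximalSpectrum (MvPolynomial (Fin 3) ℂ ⧸ J)) := Fintype.ofEquiv κ Φ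
  have := finite_localization_maximalSpectrum J
  have hfree (I : MaximalSpectrum (MvPolynomial (Fin 3) ℂ ⧸ J)) :
      Module.Free ℂ (Localization.AtPrime I.asIdeal) := Module.Free.of_divisionRing ℂ (Localization.AtPrime I.asIdeal)
  -- An Artinian ring is the product of its localizations at the maximal ideals.
  rw [((MaximalSpectrum.toPiLocalizationEquiv
    (MvPolynomial (Fin 3) ℂ ⧸ J)).toLinearEquiv.restrictScalars ℂ).finrank_eq,
    Module.finrank_pi_fintype, ← Equiv.sum_comp Φ]
  exact Finset.sum_congr rfl fun x _ =>
    ((localizationPointIdealEquiv J (hv x)).toLinearEquiv.restrictScalars ℂ).finrank_eq.symm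

end LocalGlobal
end

noncomputable section

/-! ### The dimension of the kernel is at most the intersection multiplicity -/

/-- Every term of the Leibniz expansion takes one factor from each of the columns in `s`. -/
lemma det_mem_pow_of_columns_mem {S : Type*} [CommRing S] {ι : Type*} [Fintype ι] [DecidableEq ι]
    (I : Ideal S) (M : Matrix ι ι S) (s : Finset ι) (h : ∀ j ∈ s, ∀ i, M i j ∈ I) :
    M.det ∈ I ^ s.card := by
  rw [Matrix.det_apply]
  refine sum_mem fun σ _ => ?_
  rw [Units.smul_def]
  refine zsmul_mem ?_ _
  rw [← Finset.prod_mul_prod_compl s]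
  refine Ideal.mul_mem_right _ _ ?_
  rw [← Finset.prod_const]
  exact Ideal.prod_mem_prod fun j hj => h j hj _

/-- After a constant change of basis that starts with a basis of the kernel at `v`, as many columns
of the pencil as the kernel has dimensions vanish at `v`. The determinant changes only by a nonzero
constant. -/
lemma detPoly_mem_pow {m : ℕ} (D : Fin 3 → Matrix (Fin m) (Fin m) ℂ) (v : Fin 3 → ℂ) :
    detPoly D ∈ RingHom.ker (eval v : MvPolynomial (Fin 3) ℂ →+* ℂ) ^
      Module.finrank ℂ (LinearMap.ker (pencil D v).mulVecLin) := by
  classical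
  set K := LinearMap.ker (pencil D v).mulVecLin with hK
  obtain ⟨K', hK'⟩ := K.exists_isCompl
  let b₀ : Module.Basis (Fin (Module.finrank ℂ K) ⊕ Fin (Module.finrank ℂ K')) ℂ (Fin m → ℂ) :=
    ((Module.finBasis ℂ K).prod (Module.finBasis ℂ K')).map (K.prodEquivOfIsCompl K' hK')
  have hcard : Fintype.card (Fin (Module.finrank ℂ K) ⊕ Fin (Module.finrank ℂ K'))
      = Fintype.card (Fin m) := by
    rw [← Module.finrank_eq_card_basis b₀, Module.finrank_fin_fun, Fintype.card_fin]
  let σ := Fintype.equivOfCardEq hcard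
  let b := b₀.reindex σ
  let s : Finset (Fin m) := Finset.univ.image fun k => σ (Sum.inl k)
  have hs : s.card = Module.finrank ℂ K := by
    exact (Finset.card_image_of_injective _ (σ.injective.comp Sum.inl_injective)).trans
      (by rw [Finset.card_univ, Fintype.card_fin])
  have hb : ∀ j ∈ s, (pencil D v).mulVec (b j) = 0 := by
    intro j hj
    obtain ⟨k, -, rfl⟩ := Finset.mem_image.1 hj
    have : b (σ (Sum.inl k)) = (Module.finBasis ℂ K k : Fin m → ℂ) := by
      simp [b, b₀]
    rw [this]
    exact (Module.finBasis ℂ K k).2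
  let Q : Matrix (Fin m) (Fin m) ℂ := (Pi.basisFun ℂ (Fin m)).toMatrix b
  have hQ : IsUnit Q.det := by
    have := (Pi.basisFun ℂ (Fin m)).invertibleToMatrix b
    exact Matrix.isUnit_det_of_invertible Q
  have hQb : ∀ i j, Q i j = b j i := fun i j => by simp [Q, Module.Basis.toMatrix_apply]
  have h1 := det_mem_pow_of_columns_mem (RingHom.ker (eval v : MvPolynomial (Fin 3) ℂ →+* ℂ))
    (pencilPoly D * Q.map C) s (fun j hj i => by
      have h := congrFun (hb j hj) i
      rw [RingHom.mem_ker, Matrix.mul_apply, map_sum]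
      simpa [Matrix.mulVec, dotProduct, hQb, eval_pencilPoly] using h)
  rw [hs, Matrix.det_mul, det_pencilPoly] at h1
  have h2 : (Q.map (C : ℂ →+* MvPolynomial (Fin 3) ℂ)).det = C Q.det :=
    (RingHom.map_det C Q).symm
  rw [h2] at h1
  obtain ⟨w, hw⟩ := (hQ.map (C : ℂ →+* MvPolynomial (Fin 3) ℂ)).exists_right_inv
  have h3 := Ideal.mul_mem_right w _ h1
  rwa [mul_assoc, hw, mul_one] at h3

/-- Substituting the coordinates of `v` one variable at a time gives a strict chain of prime
kernels. -/
lemma three_le_height_ker_eval (v : Fin 3 → ℂ) :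
    3 ≤ (RingHom.ker (eval v : MvPolynomial (Fin 3) ℂ →+* ℂ)).height := by
  let φ₁ : MvPolynomial (Fin 3) ℂ →ₐ[ℂ] MvPolynomial (Fin 3) ℂ := aeval ![C (v 0), X 1, X 2]
  let φ₂ : MvPolynomial (Fin 3) ℂ →ₐ[ℂ] MvPolynomial (Fin 3) ℂ :=
    aeval ![C (v 0), C (v 1), X 2]
  have e₂ : ∀ f, φ₂ f = aeval ![C (v 0), C (v 1), X 2] (φ₁ f) := by
    have : φ₂ = (aeval ![C (v 0), C (v 1), X 2]).comp φ₁ := by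
      ext i
      fin_cases i <;> simp [φ₁, φ₂, ← algebraMap_eq]
    exact DFunLike.congr_fun this
  have e₃ : ∀ f, eval v f = eval v (φ₂ f) := by
    have : aeval v = (aeval v : MvPolynomial (Fin 3) ℂ →ₐ[ℂ] ℂ).comp φ₂ := by
      ext i
      fin_cases i <;> simp [φ₂, ← algebraMap_eq]
    exact DFunLike.congr_fun this
  have hX (i : Fin 3) (c : ℂ) : (X i : MvPolynomial (Fin 3) ℂ) - C c ≠ 0 := by
    intro h
    have := congrArg (eval fun _ => c + 1) h
    simp at this
  have l₀ : (⊥ : Ideal (MvPolynomial (Fin 3) ℂ)) < RingHom.ker φ₁ := by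
    rw [bot_lt_iff_ne_bot]
    intro h
    have : X 0 - C (v 0) ∈ RingHom.ker φ₁ := by simp [RingHom.mem_ker, φ₁, ← algebraMap_eq]
    rw [h] at this
    exact hX _ _ this
  have l₁ : RingHom.ker φ₁ < RingHom.ker φ₂ := by
    refine lt_of_le_of_ne (fun f hf => ?_) fun h => ?_
    · rw [RingHom.mem_ker] at hf ⊢
      rw [e₂, hf, map_zero]
    · have : X 1 - C (v 1) ∈ RingHom.ker φ₂ := by simp [RingHom.mem_ker, φ₂, ← algebraMap_eq]
      rw [← h] at this
      simp only [RingHom.mem_ker, φ₁, map_sub, aeval_X, ← algebraMap_eq, AlgHom.commutes] at this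
      exact hX 1 (v 1) this
  have l₂ : RingHom.ker φ₂ < RingHom.ker (eval v) := by
    refine lt_of_le_of_ne (fun f hf => ?_) fun h => ?_
    · rw [RingHom.mem_ker] at hf ⊢
      rw [e₃, hf, map_zero]
    · have : X 2 - C (v 2) ∈ RingHom.ker (eval v) := by simp [RingHom.mem_ker]
      rw [← h] at this
      simp only [RingHom.mem_ker, φ₂, map_sub, aeval_X, ← algebraMap_eq, AlgHom.commutes] at this
      exact hX 2 (v 2) this
  have : (⊥ : Ideal (MvPolynomial (Fin 3) ℂ)).IsPrime := Ideal.isPrime_bot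
  have : (RingHom.ker φ₁).IsPrime := RingHom.ker_isPrime φ₁
  have : (RingHom.ker φ₂).IsPrime := RingHom.ker_isPrime φ₂
  calc (3 : ℕ∞) = 0 + 1 + 1 + 1 := by norm_num
    _ ≤ (⊥ : Ideal (MvPolynomial (Fin 3) ℂ)).height + 1 + 1 + 1 := by gcongr; exact zero_le
    _ ≤ (RingHom.ker φ₁).height + 1 + 1 := by
      gcongr
      exact Ideal.height_add_one_le_of_lt_of_isPrime l₀
    _ ≤ (RingHom.ker φ₂).height + 1 := by
      gcongr
      exact Ideal.height_add_one_le_of_lt_of_isPrime l₁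
    _ ≤ _ := Ideal.height_add_one_le_of_lt_of_isPrime l₂

section PowersOfMaximalIdeal

/-- By Nakayama's lemma the powers of `I` decrease strictly as long as they are nonzero. The `k`
steps down to `I ^ k` and the nonzero `I ^ k` itself account for `k + 1` dimensions. -/
lemma add_one_le_finrank_of_pow_ne_bot {S : Type*} [CommRing S] [IsLocalRing S] [Algebra ℂ S]
    [FiniteDimensional ℂ S] {I : Ideal S} (hI : I ≠ ⊤) {k : ℕ} (h : I ^ k ≠ ⊥) :
    k + 1 ≤ Module.finrank ℂ S := by
  have : IsNoetherianRing S := IsNoetherianRing.of_finite ℂ S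
  have hjac : I ≤ (⊥ : Ideal S).jacobson := by
    rw [IsLocalRing.jacobson_eq_maximalIdeal ⊥ bot_ne_top]
    exact IsLocalRing.le_maximalIdeal hI
  have key : ∀ i, I ^ i ≠ ⊥ →
      Module.finrank ℂ ((I ^ i).restrictScalars ℂ) + i ≤ Module.finrank ℂ S := by
    intro i
    induction i with
    | zero => intro _; exact Submodule.finrank_le _
    | succ i ih =>
      intro hi
      have hi' : I ^ i ≠ ⊥ := fun h0 => hi (by rw [pow_succ, h0, Ideal.bot_mul])
      have hlt : (I ^ (i + 1)).restrictScalars ℂ < (I ^ i).restrictScalars ℂ := by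
        refine lt_of_le_of_ne (Ideal.pow_le_pow_right (Nat.le_succ i)) fun heq => hi' ?_
        have heq' : I ^ (i + 1) = I ^ i := Submodule.restrictScalars_injective ℂ S S heq
        refine Submodule.eq_bot_of_le_smul_of_le_jacobson_bot I _
          ((isNoetherianRing_iff_ideal_fg S).1 this _) ?_ hjac
        rw [smul_eq_mul, ← pow_succ', heq']
      have := Submodule.finrank_lt_finrank_of_lt hlt
      have := ih hi'
      omega
  have h1 := key k h
  have h2 : 0 < Module.finrank ℂ ((I ^ k).restrictScalars ℂ) := by
    rw [Module.finrank_pos_iff, Submodule.nontrivial_iff_ne_bot]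
    intro h0
    exact h (Submodule.restrictScalars_injective ℂ S S h0)
  omega

end PowersOfMaximalIdeal

/-- Otherwise the maximal ideal would be minimal over an ideal with two generators. Krull's height
theorem would bound its height by two, but it is at least three. -/
lemma not_maximalIdeal_pow_le_span_pair (v : Fin 3 → ℂ) {f g : MvPolynomial (Fin 3) ℂ}
    (hf : eval v f = 0) (hg : eval v g = 0) (k : ℕ) :
    ¬ IsLocalRing.maximalIdeal (LocalRingAt v) ^ k
      ≤ Ideal.span {algebraMap _ (LocalRingAt v) f, algebraMap _ (LocalRingAt v) g} := by
  intro h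
  have hmem : ∀ {f : MvPolynomial (Fin 3) ℂ}, eval v f = 0 →
      algebraMap _ (LocalRingAt v) f ∈ IsLocalRing.maximalIdeal (LocalRingAt v) := fun hf =>
    (IsLocalization.AtPrime.to_map_mem_maximal_iff (LocalRingAt v)
      (RingHom.ker (eval v)) _).2 hf
  have hmin : IsLocalRing.maximalIdeal (LocalRingAt v) ∈ (Ideal.span
      {algebraMap _ (LocalRingAt v) f, algebraMap _ (LocalRingAt v) g}).minimalPrimes := by
    refine ⟨⟨inferInstance, ?_⟩, fun Q hQ _ => ?_⟩
    · rw [Ideal.span_le]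
      rintro _ (rfl | rfl)
      · exact hmem hf
      · exact hmem hg
    · have := hQ.1
      exact Ideal.IsPrime.le_of_pow_le (h.trans hQ.2)
  have h1 := Ideal.height_le_card_of_mem_minimalPrimes_span (Set.toFinite _) hmin
  have h2 : (2 : ℕ∞) < 3 := by norm_num
  have h3 : ((Set.ncard {algebraMap _ (LocalRingAt v) f, algebraMap _ (LocalRingAt v) g} : ℕ) : ℕ∞)
      ≤ 2 := by exact_mod_cast (Set.ncard_insert_le _ _).trans (by rw [Set.ncard_singleton])
  have h4 := three_le_height_ker_eval v
  rw [← Localization.AtPrime.under_maximalIdeal (I := RingHom.ker (eval v)),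
    IsLocalization.height_under (RingHom.ker (eval v)).primeCompl] at h4
  exact absurd (h4.trans (h1.trans h3)) (not_le.2 h2)

/-- The dimension of the kernel is at most the local intersection multiplicity. -/
lemma finrank_ker_le_finrank_localQuot {m : ℕ} (D : Fin 3 → Matrix (Fin m) (Fin m) ℂ)
    {p l : MvPolynomial (Fin 3) ℂ} {v : Fin 3 → ℂ} (hp : eval v p = 0)
    [FiniteDimensional ℂ (LocalQuot (detPoly D) p l v)] :
    Module.finrank ℂ (LinearMap.ker (pencil D v).mulVecLin)
      ≤ Module.finrank ℂ (LocalQuot (detPoly D) p l v) := by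
  rcases Nat.eq_zero_or_pos (Module.finrank ℂ (LinearMap.ker (pencil D v).mulVecLin)) with h0 | h0
  · omega
  obtain ⟨j, hj⟩ := Nat.exists_eq_succ_of_ne_zero h0.ne'
  have hΔ := detPoly_mem_pow D v
  rw [hj] at hΔ ⊢
  set M := IsLocalRing.maximalIdeal (LocalRingAt v)
  set J := Ideal.map (algebraMap (MvPolynomial (Fin 3) ℂ) (LocalRingAt v))
    (Ideal.span {detPoly D, p, l - C (eval v l)}) with hJdef
  have hmem : ∀ {f : MvPolynomial (Fin 3) ℂ}, eval v f = 0 →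
      algebraMap _ (LocalRingAt v) f ∈ M := fun hf =>
    (IsLocalization.AtPrime.to_map_mem_maximal_iff (LocalRingAt v)
      (RingHom.ker (eval v)) _).2 hf
  have hl : eval v (l - C (eval v l)) = 0 := by simp
  have hΔM : algebraMap _ (LocalRingAt v) (detPoly D) ∈ M ^ (j + 1) := by
    have := Ideal.mem_map_of_mem (algebraMap _ (LocalRingAt v)) hΔ
    rw [Ideal.map_pow] at this
    exact Ideal.pow_right_mono (Ideal.map_le_iff_le_comap.2 fun f hf => hmem hf) _ this
  let K := Ideal.span {algebraMap _ (LocalRingAt v) p,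
    algebraMap _ (LocalRingAt v) (l - C (eval v l))}
  -- Modulo `M ^ (j + 1)` the determinant disappears, and only two generators of `J` remain.
  have hJK : J ≤ K ⊔ M ^ (j + 1) := by
    rw [hJdef, Ideal.map_le_iff_le_comap, Ideal.span_le]
    rintro f (rfl | rfl | rfl)
    · exact Ideal.mem_sup_right hΔM
    · exact Ideal.mem_sup_left (Ideal.subset_span (by simp))
    · exact Ideal.mem_sup_left (Ideal.subset_span (by simp))
  have hKM : K ≤ M := by
    rw [Ideal.span_le]
    rintro _ (rfl | rfl)
    · exact hmem hp
    · exact hmem hl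
  have hJM : J ≤ M := hJK.trans (sup_le hKM (Ideal.pow_le_self (Nat.succ_ne_zero j)))
  have : Nontrivial (LocalRingAt v ⧸ J) := Ideal.Quotient.nontrivial_iff.2
    fun h => Ideal.IsPrime.ne_top' (top_le_iff.1 (h ▸ hJM))
  have : IsLocalRing (LocalRingAt v ⧸ J) :=
    IsLocalRing.of_surjective' (Ideal.Quotient.mk J) Ideal.Quotient.mk_surjective
  refine add_one_le_finrank_of_pow_ne_bot (I := M.map (Ideal.Quotient.mk J)) ?_ ?_
  · intro h
    have h1 := congrArg (Ideal.comap (Ideal.Quotient.mk J)) h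
    rw [Ideal.comap_map_of_surjective' _ Ideal.Quotient.mk_surjective, Ideal.mk_ker,
      sup_eq_left.2 hJM, Ideal.comap_top] at h1
    exact Ideal.IsPrime.ne_top' h1
  · rw [← Ideal.map_pow, Ne, Ideal.map_eq_bot_iff_le_ker, Ideal.mk_ker]
    intro h
    -- If `M ^ j ≤ J`, then `M ^ j ≤ K ⊔ M * M ^ j`, and Nakayama's lemma removes the second
    -- summand.
    refine not_maximalIdeal_pow_le_span_pair v hp hl j ?_
    refine Submodule.le_of_le_smul_of_le_jacobson_bot (I := M)
      ((isNoetherianRing_iff_ideal_fg (LocalRingAt v)).1 inferInstance _) ?_ ?_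
    · rw [IsLocalRing.jacobson_eq_maximalIdeal ⊥ bot_ne_top]
    · rw [smul_eq_mul, ← pow_succ']
      exact h.trans hJK

end

noncomputable section

/-! ### Bezout's theorem and the span of the Vandermonde vectors -/

lemma chartIdeal_eq {q p : MvPolynomial (Fin 3) ℂ} {t : ℂ} {v : Fin 3 → ℂ}
    (hv : eval v (lineForm t) = 1) :
    chartIdeal q p t = Ideal.span {q, p, lineForm t - C (eval v (lineForm t))} := by
  rw [hv, map_one, chartIdeal]

/-- Bezout's theorem for a system `v` of representatives of the common zeros of two coprime
forms. -/
lemma sum_intersectionMult {q p : MvPolynomial (Fin 3) ℂ} {a n : ℕ} (ha : a ≠ 0) (hn : n ≠ 0)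
    (hq : q ∈ forms a) (hp : p ∈ forms n) (hirr : Irreducible q) (hndvd : ¬ q ∣ p) {t : ℂ}
    (hrel : IsRelPrime (planeRestrict t q) (planeRestrict t p))
    {κ : Type*} [Fintype κ] (v : κ → Fin 3 → ℂ) (hv0 : ∀ x, v x ≠ 0)
    (hv : ∀ x y, x ≠ y → ∀ c : ℂ, v x ≠ c • v y)
    (hvq : ∀ x, eval (v x) q = 0) (hvp : ∀ x, eval (v x) p = 0)
    (hall : ∀ w, w ≠ 0 → eval w q = 0 → eval w p = 0 → ∃ x, ∃ c : ℂ, w = c • v x)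
    (ht : ∀ x, eval (v x) (lineForm t) ≠ 0) :
    (∀ x, FiniteDimensional ℂ (LocalQuot q p (chartForm (v x)) (v x))) ∧
      ∑ x, intersectionMult q p (v x) = a * n := by
  obtain ⟨hfd, hdim⟩ := finrank_quotient_chartIdeal ha hn hq hp hirr hndvd hrel
  -- The rescaled representatives `v'` are exactly the zeros of the chart ideal.
  let s : κ → ℂ := fun x => eval (v x) (lineForm t)
  have hs : ∀ x, s x ≠ 0 := ht
  let v' : κ → Fin 3 → ℂ := fun x => (s x)⁻¹ • v x
  have hv' : ∀ {k : ℕ} {f : MvPolynomial (Fin 3) ℂ}, f ∈ forms k → ∀ x,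
      eval (v' x) f = (s x)⁻¹ ^ k * eval (v x) f :=
    fun hf x => eval_smul_of_mem_forms hf _ _
  have hL : ∀ x, eval (v' x) (lineForm t) = 1 := fun x => by
    rw [hv' (k := 1) (lineForm_mem_forms t), pow_one, inv_mul_cancel₀ (hs x)]
  have hzero : ∀ x, ∀ f ∈ chartIdeal q p t, eval (v' x) f = 0 := by
    intro x f hf
    obtain ⟨u₁, u₂, u₃, rfl⟩ := mem_chartIdeal.1 hf
    simp [hv' hq, hv' hp, hvq, hvp, hL]
  have hinj : Function.Injective v' := by
    intro x y hxy
    by_contra hne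
    refine hv x y hne (s x * (s y)⁻¹) ?_
    rw [mul_smul]
    change v x = s x • v' y
    rw [← hxy, smul_inv_smul₀ (hs x)]
  have hsurj : ∀ w, (∀ f ∈ chartIdeal q p t, eval w f = 0) → ∃ x, v' x = w := by
    intro w hw
    have h1 := hw (lineForm t - 1) (mem_chartIdeal.2 ⟨0, 0, 1, by ring⟩)
    rw [map_sub, map_one, sub_eq_zero] at h1
    have hw0 : w ≠ 0 := by
      rintro rfl
      rw [eval_lineForm] at h1
      simp at h1
    obtain ⟨x, c, rfl⟩ := hall w hw0 (hw q (mem_chartIdeal.2 ⟨1, 0, 0, by ring⟩))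
      (hw p (mem_chartIdeal.2 ⟨0, 1, 0, by ring⟩))
    refine ⟨x, ?_⟩
    rw [eval_smul_of_mem_forms (n := 1) (lineForm_mem_forms t), pow_one] at h1
    rw [eq_inv_of_mul_eq_one_left h1]
  -- The multiplicity at each point is defined in that point's own chart; the decomposition of the
  -- quotient uses the common one.
  have hequiv (x : κ) : Nonempty (LocalQuot q p (lineForm t) (v' x) ≃ₐ[ℂ]
      LocalQuot q p (chartForm (v x)) (v x)) :=
    nonempty_localQuot_algEquiv (c := (s x)⁻¹) hq hp (chartForm_mem_forms _)
      (lineForm_mem_forms t) rfl (eval_chartForm_ne_zero (hv0 x)) (by rw [hL]; exact one_ne_zero)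
  have hfd' (x : κ) : FiniteDimensional ℂ (LocalQuot q p (lineForm t) (v' x)) := by
    have := finite_localQuotient (chartIdeal q p t) (hzero x)
    rwa [chartIdeal_eq (hL x)] at this
  have hfr (x : κ) : Module.finrank ℂ (LocalRingAt (v' x) ⧸
        Ideal.map (algebraMap (MvPolynomial (Fin 3) ℂ) (LocalRingAt (v' x))) (chartIdeal q p t))
      = intersectionMult q p (v x) := by
    rw [chartIdeal_eq (hL x), intersectionMult_eq]
    exact (hequiv x).some.toLinearEquiv.finrank_eq
  refine ⟨fun x => ?_, ?_⟩
  · have := hfd' x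
    exact Module.Finite.equiv (hequiv x).some.toLinearEquiv
  · rw [← hdim, ← sum_finrank_localQuotient (chartIdeal q p t) v' hinj hzero hsurj]
    exact Finset.sum_congr rfl fun x _ => (hfr x).symm

/-! ### The Vandermonde map on families of kernel vectors. -/

section Vandermonde

variable {m : ℕ} (D : Fin 3 → Matrix (Fin m) (Fin m) ℂ)

/-- `V_n(v, e)` as a linear function of `e`. -/
def vandermondeMap (m n : ℕ) (v : Fin 3 → ℂ) : (Fin m → ℂ) →ₗ[ℂ] BlownUpSpace m n where
  toFun := vandermondeVec n v
  map_add' e e' := by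
    ext i k
    simp [vandermondeVec, mul_add]
  map_smul' c e := by
    ext i k
    simp [vandermondeVec, mul_left_comm]

/-- The combination of the Vandermonde vectors belonging to a family of kernel vectors. -/
def vandermondeSum {κ : Type*} [Fintype κ] (n : ℕ) (v : κ → Fin 3 → ℂ) :
    (∀ x, LinearMap.ker (pencil D (v x)).mulVecLin) →ₗ[ℂ] BlownUpSpace m n :=
  ∑ x, vandermondeMap m n (v x) ∘ₗ (LinearMap.ker (pencil D (v x)).mulVecLin).subtype ∘ₗ
    LinearMap.proj x

variable {κ : Type*} [Fintype κ] {n : ℕ} {v : κ → Fin 3 → ℂ}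

lemma vandermondeSum_apply (e : ∀ x, LinearMap.ker (pencil D (v x)).mulVecLin) :
    vandermondeSum D n v e = ∑ x, vandermondeVec n (v x) (e x : Fin m → ℂ) := by
  simp [vandermondeSum, vandermondeMap, LinearMap.sum_apply]

lemma vandermondeSum_single [DecidableEq κ] (x : κ)
    (e : LinearMap.ker (pencil D (v x)).mulVecLin) :
    vandermondeSum D n v (Pi.single x e) = vandermondeVec n (v x) (e : Fin m → ℂ) := by
  rw [vandermondeSum_apply, Finset.sum_eq_single x]
  · rw [Pi.single_eq_same]
  · intro y _ hy
    rw [Pi.single_eq_of_ne hy]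
    exact (vandermondeMap m n (v y)).map_zero
  · simp

variable {D}

lemma sum_eval_pencilPoly_transpose_eq_zero {v : Fin 3 → ℂ} {e : Fin m → ℂ}
    (he : (pencil D v).mulVec e = 0) (j : Fin m) :
    ∑ i, eval v ((pencilPoly D).transpose i j) * e i = 0 := by
  simp only [Matrix.transpose_apply, eval_pencilPoly]
  exact congrFun he j

lemma vandermondeVec_mem_principalSubspace {N : ℕ} {v : Fin 3 → ℂ} {e : Fin m → ℂ}
    (he : (pencil D v).mulVec e = 0) :
    vandermondeVec (N + 1) v e ∈ principalSubspace D (N + 1) := by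
  rw [mem_principalSubspace_iff]
  intro g hg
  have h := mulVec_mem_formTuples (A := (pencilPoly D).transpose)
    (fun i j => pencilPoly_mem_forms D j i) hg
  rw [add_sub_cancel] at h
  rw [blockPairing_vandermondeVec v e h]
  have : ∀ i, eval v ((pencilPoly D).transpose.mulVec g i) * e i
      = ∑ j, eval v (g j) * (eval v ((pencilPoly D).transpose i j) * e i) := fun i => by
    simp only [Matrix.mulVec, dotProduct, map_sum, map_mul, Finset.sum_mul]
    exact Finset.sum_congr rfl fun j _ => by ring
  simp_rw [this]
  rw [Finset.sum_comm]
  refine Finset.sum_eq_zero fun j _ => ?_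
  rw [← Finset.mul_sum, sum_eval_pencilPoly_transpose_eq_zero he, mul_zero]

lemma range_vandermondeSum_le {N : ℕ} :
    LinearMap.range (vandermondeSum D (N + 1) v) ≤ principalSubspace D (N + 1) := by
  rintro _ ⟨e, rfl⟩
  rw [vandermondeSum_apply]
  exact sum_mem fun x _ => vandermondeVec_mem_principalSubspace (e x).2

/-- A kernel vector of the pencil is a left kernel vector of its transpose. With entries of degree
`a = 1` and `p` of degree `N + 1`, the bound `a + n ≤ d + 2` holds with equality at `d = N`: the
size of `W_n` is just enough for independence. -/
lemma vandermondeSum_injective {N : ℕ} {p : MvPolynomial (Fin 3) ℂ} {t : ℂ}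
    (hp : p ∈ forms (N + 1 : ℕ)) (hirr : Irreducible (detPoly D)) (hndvd : ¬ detPoly D ∣ p)
    (hrel : IsRelPrime (planeRestrict t (detPoly D)) (planeRestrict t p))
    (hL : ∀ x, eval (v x) (lineForm t) ≠ 0)
    (hv : ∀ x y, x ≠ y → ∀ c : ℂ, v x ≠ c • v y) (hvp : ∀ x, eval (v x) p = 0) :
    Function.Injective (vandermondeSum D (N + 1) v) := by
  have hdet : (pencilPoly D).transpose.det = detPoly D := by
    rw [Matrix.det_transpose, det_pencilPoly]
  rw [injective_iff_map_eq_zero]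
  intro e he
  have key := eq_zero_of_sum_eval_formTuples_eq_zero (A := (pencilPoly D).transpose) (a := 1)
    (d := N) (fun i j => pencilPoly_mem_forms D j i) hp (hdet ▸ hirr) (hdet ▸ hndvd)
    (hdet ▸ hrel) (hdet ▸ planeRestrict_ne_zero (Nat.succ_ne_zero N) hp hrel) (by omega)
    v hL hv hvp (fun x => (e x : Fin m → ℂ))
    (fun x j => sum_eval_pencilPoly_transpose_eq_zero (e x).2 j) fun f hf => by
      have h1 := congrArg (fun w => blockPairing m N w f) he
      simp only [vandermondeSum_apply, map_sum, LinearMap.sum_apply,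
        blockPairing_vandermondeVec _ _ hf, map_zero, LinearMap.zero_apply] at h1
      exact h1
  ext1 x
  exact Subtype.ext (congrFun key x)

lemma linearIndependent_vandermondeVec (hinj : Function.Injective (vandermondeSum D n v))
    {e : κ → Fin m → ℂ} (he : ∀ x, e x ≠ 0 ∧ (pencil D (v x)).mulVec (e x) = 0) :
    LinearIndependent ℂ fun x => vandermondeVec n (v x) (e x) := by
  rw [Fintype.linearIndependent_iff]
  intro g hg x
  have h1 : vandermondeSum D n v (fun x => g x • ⟨e x, (he x).2⟩) = 0 := by
    rw [vandermondeSum_apply, ← hg]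
    exact Finset.sum_congr rfl fun x _ => (vandermondeMap m n (v x)).map_smul (g x) (e x)
  have h2 := congrArg Subtype.val (congrFun ((map_eq_zero_iff _ hinj).1 h1) x)
  exact (smul_eq_zero.1 h2).resolve_right (he x).1

lemma vandermondeVec_basis_eq {τ : κ → Type*}
    (e : ∀ x, Module.Basis (τ x) ℂ (LinearMap.ker (pencil D (v x)).mulVecLin)) :
    (fun s : (Σ x, τ x) => vandermondeVec n (v s.1) (e s.1 s.2 : Fin m → ℂ))
      = vandermondeSum D n v ∘ Pi.basis e := by
  classical
  funext s
  rw [Function.comp_apply, Pi.basis_apply, vandermondeSum_single]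

lemma span_vandermondeVec_basis {τ : κ → Type*}
    (e : ∀ x, Module.Basis (τ x) ℂ (LinearMap.ker (pencil D (v x)).mulVecLin)) :
    Submodule.span ℂ (Set.range fun s : (Σ x, τ x) =>
        vandermondeVec n (v s.1) (e s.1 s.2 : Fin m → ℂ))
      = LinearMap.range (vandermondeSum D n v) := by
  rw [vandermondeVec_basis_eq, Set.range_comp, Submodule.span_image, (Pi.basis e).span_eq,
    LinearMap.range_eq_map]

lemma finrank_range_vandermondeSum (hinj : Function.Injective (vandermondeSum D n v)) :
    Module.finrank ℂ (LinearMap.range (vandermondeSum D n v))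
      = ∑ x, Module.finrank ℂ (LinearMap.ker (pencil D (v x)).mulVecLin) := by
  rw [LinearMap.finrank_range_of_inj hinj, Module.finrank_pi_fintype]

end Vandermonde

end

/-! ### The theorem. -/

/-- `X` picks homogeneous coordinates for the zeros of `p` on the curve. The first part takes one
kernel vector at each zero, the second a basis of the kernel at each zero. -/
theorem theorem2p5 {m n : ℕ} (D : Fin 3 → Matrix (Fin m) (Fin m) ℂ)
    (hD : ∀ k, (D k).IsHermitian)
    (hirr : Irreducible (detPoly D))
    (p : MvPolynomial (Fin 3) ℂ) (hp : p.IsHomogeneous n)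
    (hndvd : ¬ detPoly D ∣ p)
    (X : commonZeros (detPoly D) p → Fin 3 → ℂ)
    (hX0 : ∀ x, X x ≠ 0)
    (hX : ∀ x, Projectivization.mk ℂ (X x) (hX0 x) = x.1) :
    (∀ e : commonZeros (detPoly D) p → Fin m → ℂ,
      (∀ x, e x ≠ 0 ∧ (pencil D (X x)).mulVec (e x) = 0) →
        LinearIndependent ℂ (fun x => vandermondeVec n (X x) (e x)) ∧
        ((∀ x, intersectionMult (detPoly D) p (X x) = 1) →
          Submodule.span ℂ (Set.range fun x => vandermondeVec n (X x) (e x))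
            = principalSubspace D n)) ∧
    (∀ (κ : commonZeros (detPoly D) p → Type)
      (e : ∀ x, Module.Basis (κ x) ℂ (LinearMap.ker (pencil D (X x)).mulVecLin)),
        LinearIndependent ℂ
          (fun s : (Σ x, κ x) => vandermondeVec n (X s.1) (e s.1 s.2 : Fin m → ℂ)) ∧
        (Submodule.span ℂ (Set.range
            fun s : (Σ x, κ x) => vandermondeVec n (X s.1) (e s.1 s.2 : Fin m → ℂ))
            = principalSubspace D n ↔
          ∀ x, Module.finrank ℂ (LinearMap.ker (pencil D (X x)).mulVecLin)
            = intersectionMult (detPoly D) p (X x))) := by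
  classical
  have hzero : ∀ x : commonZeros (detPoly D) p, ∃ c : ℂ, X x = c • x.1.rep := fun x => by
    have h := hX x
    rw [← x.1.mk_rep] at h
    obtain ⟨c, hc⟩ := (Projectivization.mk_eq_mk_iff' ℂ _ _ _ _).1 h
    exact ⟨c, hc.symm⟩
  have hq := detPoly_mem_forms D
  have hpf : p ∈ forms n := mem_forms_iff_isHomogeneous.2 hp
  have hXq : ∀ x, eval (X x) (detPoly D) = 0 := fun x => by
    obtain ⟨c, hc⟩ := hzero x
    rw [hc, eval_smul_of_mem_forms hq, x.2.1, mul_zero]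
  have hXp : ∀ x, eval (X x) p = 0 := fun x => by
    obtain ⟨c, hc⟩ := hzero x
    rw [hc, eval_smul_of_mem_forms hpf, x.2.2, mul_zero]
  -- For `n = 0` the polynomial is a nonzero constant, so there are no zeros, and `W_0 = 0`.
  rcases n with _ | N
  · have hempty : IsEmpty (commonZeros (detPoly D) p) := ⟨fun x => hndvd <| by
      have h := hXp x
      have hc := totalDegree_eq_zero_iff_eq_C.1 (Nat.le_zero.1 hp.totalDegree_le)
      rw [hc, eval_C] at h
      rw [hc, h, map_zero]
      exact dvd_zero _⟩
    have hblock : IsEmpty (BlockIndex 0) := ⟨fun β => by have := β.2; omega⟩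
    exact ⟨fun e _ => ⟨linearIndependent_empty_type, fun _ => Subsingleton.elim _ _⟩,
      fun κ e => ⟨linearIndependent_empty_type,
        ⟨fun _ x => isEmptyElim x, fun _ => Subsingleton.elim _ _⟩⟩⟩
  -- The determinant of the empty matrix is `1`, which is not irreducible.
  have hm : m ≠ 0 := by
    rintro rfl
    exact hirr.not_isUnit (by rw [← det_pencilPoly, Matrix.det_isEmpty]; exact isUnit_one)
  have hfin : Finite (commonZeros (detPoly D) p) := finite_commonZeros hq hpf hirr hndvd
  have := Fintype.ofFinite (commonZeros (detPoly D) p)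
  have hXne : ∀ x y, x ≠ y → ∀ c : ℂ, X x ≠ c • X y := fun x y hxy c hc => hxy <| Subtype.ext <| by
    rw [← hX x, ← hX y]
    exact mk_eq_mk_of_eq_smul _ _ hc
  have hall : ∀ w, w ≠ 0 → eval w (detPoly D) = 0 → eval w p = 0 →
      ∃ x, ∃ c : ℂ, w = c • X x := fun w hw h1 h2 => by
    obtain ⟨c, hc⟩ := Projectivization.exists_smul_eq_mk_rep ℂ w hw
    have hmem : Projectivization.mk ℂ w hw ∈ commonZeros (detPoly D) p := by
      refine ⟨?_, ?_⟩
      · rw [← hc, Units.smul_def, eval_smul_of_mem_forms hq, h1, mul_zero]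
      · rw [← hc, Units.smul_def, eval_smul_of_mem_forms hpf, h2, mul_zero]
    obtain ⟨b, hb⟩ := (Projectivization.mk_eq_mk_iff' ℂ _ _ _ _).1 (hX ⟨_, hmem⟩).symm
    exact ⟨⟨_, hmem⟩, b, hb.symm⟩
  -- A line that misses the finitely many common zeros; its complement is the common chart.
  obtain ⟨t, ht⟩ := exists_lineForm_ne_zero X hX0
  have hrel : IsRelPrime (planeRestrict t (detPoly D)) (planeRestrict t p) :=
    isRelPrime_planeRestrict fun w hw h1 h2 => by
      obtain ⟨x, c, rfl⟩ := hall w hw h1 h2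
      rw [eval_smul_of_mem_forms (n := 1) (lineForm_mem_forms t), pow_one]
      exact mul_ne_zero (fun hc => hw (by rw [hc, zero_smul])) (ht x)
  obtain ⟨hfd, hsum⟩ := sum_intersectionMult hm (Nat.succ_ne_zero N) hq hpf hirr hndvd hrel X hX0
    hXne hXq hXp hall ht
  have hinj := vandermondeSum_injective hpf hirr hndvd hrel ht hXne hXp
  have hle : ∀ x, Module.finrank ℂ (LinearMap.ker (pencil D (X x)).mulVecLin)
      ≤ intersectionMult (detPoly D) p (X x) := fun x => by
    have := hfd x
    exact finrank_ker_le_finrank_localQuot D (hXp x)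
  have hdim := finrank_principalSubspace D (N := N) hirr.ne_zero
  refine ⟨fun e he => ?_, fun κ e => ?_⟩
  · have hli := linearIndependent_vandermondeVec hinj he
    refine ⟨hli, fun hI => Submodule.eq_of_le_of_finrank_eq ?_ ?_⟩
    · rw [Submodule.span_le]
      rintro _ ⟨x, rfl⟩
      exact vandermondeVec_mem_principalSubspace (he x).2
    -- When all multiplicities are `1`, Bezout's theorem says that the number of zeros is the
    -- dimension of `V_n`.
    · rw [finrank_span_eq_card hli, hdim, ← hsum]
      simp [hI]
  · refine ⟨?_, ?_⟩
    · rw [vandermondeVec_basis_eq]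
      exact (Pi.basis e).linearIndependent.map' _ (LinearMap.ker_eq_bot.2 hinj)
    · rw [span_vandermondeVec_basis]
      have hrank := finrank_range_vandermondeSum hinj
      -- Since the inequality holds at each zero, equality of the total dimensions forces equality
      -- at every zero.
      have hiff := Finset.sum_eq_sum_iff_of_le (s := Finset.univ) fun x _ => hle x
      constructor
      · intro h x
        refine hiff.1 ?_ x (Finset.mem_univ x)
        rw [← hrank, h, hdim, hsum]
      · intro h
        refine Submodule.eq_of_le_of_finrank_eq range_vandermondeSum_le ?_
        rw [hrank, hdim, ← hsum]
        exact hiff.2 fun x _ => h x
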